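/- For integers $p \ge 2$ and $n\ge 1$ let $J=(J_{i_1,\dots,i_p})_{1\le i_1,\dots,i_p\le n}$ have i.i.d. standard normal entries, and for $\sigma\in\Sigma_n=\{-1,1\}^n$ let $$H(\sigma)=n^{-\frac{p+1}{2}}\sum_{1\le i_1,\dots,i_p\le n}J_{i_1,\dots,i_p}\sigma_{i_1}\cdots\sigma_{i_p}.$$ Put $$Z_\beta=\sum_{\sigma\in\Sigma_n}e^{\beta nH(\sigma)},\qquad Z_\beta[\kappa_1,\kappa_2]=\sum_{\sigma\in\Sigma_n:\ \kappa_1\sqrt{2\ln 2}\le H(\sigma)\le\kappa_2\sqrt{2\ln 2}}e^{\beta nH(\sigma)},\qquad \mu_\beta(A)=\frac1{Z_\beta}\sum_{\sigma\in A}e^{\beta nH(\sigma)}\quad(A\subseteq\Sigma_n).$$ **Proposition.** For every $0<\beta<\sqrt{2\ln 2}$ and $0<\kappa<1/\sqrt2$ there is a $P^*\in\mathbb N$ such that for every fixed $p\ge P^*$ there are constants $0<c\le C$ for which, with probability tending to $1$ as $n\to\infty$, both of the following hold. 1. $Z_\beta=Z_\beta\left[\frac{\beta}{\sqrt{2\ln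 2}}-\kappa,\ \frac{\beta}{\sqrt{2\ln 2}}+\kappa\right](1+e^{-x})$ for some (random) $x\in[cn,Cn]$. 2. $\mu_\beta\left(\left\{\sigma\in\Sigma_n:\frac{H(\sigma)}{\sqrt{2\ln 2}}\in\left[\frac{\beta}{\sqrt{2\ln 2}}-\kappa,\ \frac{\beta}{\sqrt{2\ln 2}}+\kappa\right]\right\}\right)=1-e^{-y}$ for some (random) $y\in[cn,Cn]$. That is, $Z_\beta=Z_\beta\left[\frac{\beta}{\sqrt{2\ln 2}}\pm\kappa\right](1+e^{-\Theta(n)})$, and the energy band carries Gibbs mass $1-e^{-\Theta(n)}$. -/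

import Mathlib

open MeasureTheory ProbabilityTheory Filter Topology

namespace PSpin

/-- An order-`p` tensor in `(ℝⁿ)^{⊗p}`, given by its entries `J_{i₁,…,i_p}`. -/
abbrev Tensor (n p : ℕ) : Type := (Fin p → Fin n) → ℝ

/-- The law of a tensor whose entries are i.i.d. standard normal. -/
noncomputable def disorder (n p : ℕ) : Measure (Tensor n p) :=
  Measure.pi fun _ => gaussianReal 0 1

/-- The discrete hypercube `{-1, 1}ⁿ`. -/
noncomputable def hypercube (n : ℕ) : Finset (Fin n → ℝ) :=
  Fintype.piFinset fun _ => {-1, 1}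

/-- The pure `p`-spin Hamiltonian
`H(σ) = n^{-(p+1)/2} ∑_{i₁,…,i_p} J_{i₁,…,i_p} σ_{i₁} ⋯ σ_{i_p}`. -/
noncomputable def hamiltonian {n p : ℕ} (J : Tensor n p) (σ : Fin n → ℝ) : ℝ :=
  (n : ℝ) ^ (-((p : ℝ) + 1) / 2) * ∑ i : Fin p → Fin n, J i * ∏ k, σ (i k)

/-- The contribution `∑_{σ ∈ Σₙ ∩ A} e^{β n H(σ)}` of a set `A` of configurations. -/
noncomputable def weight {n p : ℕ} (β : ℝ) (J : Tensor n p) (A : Set (Fin n → ℝ)) : ℝ :=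
  open Classical in
  ∑ σ ∈ hypercube n with σ ∈ A, Real.exp (β * n * hamiltonian J σ)

/-- The partition function `Z_β = ∑_{σ ∈ Σₙ} e^{β n H(σ)}`. -/
noncomputable def partition {n p : ℕ} (β : ℝ) (J : Tensor n p) : ℝ :=
  ∑ σ ∈ hypercube n, Real.exp (β * n * hamiltonian J σ)

/-- The restricted partition function `Z_β[κ₁, κ₂]`, the sum over the `σ ∈ Σₙ` with
`κ₁ √(2 ln 2) ≤ H(σ) ≤ κ₂ √(2 ln 2)`. -/
noncomputable def restrictedPartition {n p : ℕ} (β : ℝ) (J : Tensor n p) (κ₁ κ₂ : ℝ) : ℝ :=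
  weight β J {σ | κ₁ * √(2 * Real.log 2) ≤ hamiltonian J σ ∧
    hamiltonian J σ ≤ κ₂ * √(2 * Real.log 2)}

/-- The Gibbs mass `μ_β(A) = Z_β⁻¹ ∑_{σ ∈ Σₙ ∩ A} e^{β n H(σ)}`. -/
noncomputable def gibbs {n p : ℕ} (β : ℝ) (J : Tensor n p) (A : Set (Fin n → ℝ)) : ℝ :=
  weight β J A / partition β J

end PSpin

/-!
The number of configurations with energy in a window `s ⊆ [-b, b]` has mean about
`exp (n (log 2 - b² / 2))`, and it concentrates by the second moment method. The energies of two
configurations are Gaussian with correlation the `p`-th power of their overlap, so for large `p`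
only pairs with overlap close to `± 1` are correlated; when `b² / 2 < log 2` there are too few of
them to contribute. Hence the configurations with energy near `e` have total weight at least
`exp (n (log 2 - e² / 2 + β e - o(1)))`.

At `e = β` this matches the annealed bound `E Z_β = exp (n (log 2 + β² / 2))`. Tilting the inverse
temperature to `β ± d` and applying the annealed bound to `Z_{β ± d}` shows that the energies at
distance more than `d` from `β` lose a factor `exp (-n d² / 2)`. They do not lose more than an
exponential factor, because some subcritical level `e` lies outside the band.
-/

namespace PSpin

section HighProbability

variable {Ω : ℕ → Type*} [∀ n, MeasurableSpace (Ω n)] {μ : ∀ n, Measure (Ω n)}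
  {E F : ∀ n, Ω n → Prop}

/-- The events `E n` hold with probability tending to one. This is phrased through the complements
because outer measure is only subadditive, and the `E n` are not assumed to be measurable. -/
def WithHighProbability (μ : ∀ n, Measure (Ω n)) (E : ∀ n, Ω n → Prop) : Prop :=
  Tendsto (fun n => μ n {ω | ¬ E n ω}) atTop (𝓝 0)

lemma WithHighProbability.mono (hE : WithHighProbability μ E)
    (hEF : ∀ᶠ n in atTop, ∀ ω, E n ω → F n ω) : WithHighProbability μ F := by
  refine tendsto_of_tendsto_of_tendsto_of_le_of_le' tendsto_const_nhds hE
    (Eventually.of_forall fun _ => zero_le) ?_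
  filter_upwards [hEF] with n hn
  exact measure_mono fun ω hω hEω => hω (hn ω hEω)

lemma WithHighProbability.and (hE : WithHighProbability μ E) (hF : WithHighProbability μ F) :
    WithHighProbability μ fun n ω => E n ω ∧ F n ω := by
  have hsum := Tendsto.add hE hF
  rw [add_zero] at hsum
  refine tendsto_of_tendsto_of_tendsto_of_le_of_le tendsto_const_nhds hsum
    (fun _ => zero_le) fun n => ?_
  simp only [not_and_or]
  exact measure_union_le _ _

lemma WithHighProbability.of_forall_measureReal_le [∀ n, IsFiniteMeasure (μ n)]
    (h : ∀ ε > 0, ∀ᶠ n in atTop, (μ n).real {ω | ¬ E n ω} ≤ ε) : WithHighProbability μ E := by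
  refine (ENNReal.tendsto_toReal_iff (fun n => measure_ne_top _ _) ENNReal.zero_ne_top).1 ?_
  refine tendsto_order.2 ⟨fun a ha => Eventually.of_forall fun n =>
    ha.trans_le measureReal_nonneg, fun a ha => ?_⟩
  filter_upwards [h (a / 2) (half_pos ha)] with n hn
  exact hn.trans_lt (half_lt_self ha)

lemma WithHighProbability.tendsto_measure [∀ n, IsProbabilityMeasure (μ n)]
    (hE : WithHighProbability μ E) : Tendsto (fun n => μ n {ω | E n ω}) atTop (𝓝 1) := by
  have hsub := ENNReal.Tendsto.sub (tendsto_const_nhds (x := (1 : ENNReal))) hE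
    (Or.inl ENNReal.one_ne_top)
  rw [tsub_zero] at hsub
  refine tendsto_of_tendsto_of_tendsto_of_le_of_le hsub tendsto_const_nhds (fun n => ?_)
    fun n => prob_le_one
  rw [tsub_le_iff_right, ← measure_univ (μ := μ n)]
  refine (measure_mono fun ω _ => ?_).trans (measure_union_le _ _)
  exact em (E n ω)

end HighProbability

section SecondMomentMethod

variable {Ω : Type*} [MeasurableSpace Ω] {μ : Measure Ω} [IsProbabilityMeasure μ]

lemma measureReal_le_half_integral_le {N : Ω → ℝ} {ε : ℝ} (hN : MemLp N 2 μ) (hpos : 0 < μ[N])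
    (hsq : μ[N ^ 2] ≤ (1 + ε) * μ[N] ^ 2) : μ.real {ω | N ω ≤ μ[N] / 2} ≤ 4 * ε := by
  have hvar : Var[N; μ] ≤ ε * μ[N] ^ 2 := by
    rw [variance_eq_sub hN]
    linarith
  have hsub : {ω | N ω ≤ μ[N] / 2} ⊆ {ω | μ[N] / 2 ≤ |N ω - μ[N]|} := fun ω hω => by
    have hω' : N ω ≤ μ[N] / 2 := hω
    rw [Set.mem_ofPred_eq, abs_sub_comm]
    exact le_trans (by linarith) (le_abs_self _)
  calc μ.real {ω | N ω ≤ μ[N] / 2} ≤ Var[N; μ] / (μ[N] / 2) ^ 2 := by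
        have hcheb := ENNReal.toReal_mono (by finiteness)
          ((measure_mono hsub).trans (meas_ge_le_variance_div_sq hN (half_pos hpos)))
        rwa [ENNReal.toReal_ofReal (div_nonneg (variance_nonneg _ _) (by positivity))] at hcheb
    _ ≤ 4 * ε := by
        rw [div_le_iff₀ (by positivity)]
        linarith

variable {ι : Type*} (I : Finset ι) {S : ι → Set Ω}

open Classical in
lemma measureReal_card_filter_mem_le_half (hS : ∀ i ∈ I, MeasurableSet (S i)) {M ε : ℝ}
    (hM : 0 < M) (hfirst : ∑ i ∈ I, μ.real (S i) = M)
    (hsecond : ∑ i ∈ I, ∑ j ∈ I, μ.real (S i ∩ S j) ≤ (1 + ε) * M ^ 2) :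
    μ.real {ω | ((I.filter fun i => ω ∈ S i).card : ℝ) ≤ M / 2} ≤ 4 * ε := by
  set N : Ω → ℝ := fun ω => ∑ i ∈ I, (S i).indicator 1 ω with hNdef
  have hcard : ∀ ω, ((I.filter fun i => ω ∈ S i).card : ℝ) = N ω := fun ω => by
    simp [hNdef, Set.indicator_apply]
  have hint : ∀ T, MeasurableSet T → Integrable (T.indicator (1 : Ω → ℝ)) μ := fun T hT =>
    (integrable_const (1 : ℝ)).indicator hT
  have hmean : μ[N] = M := by
    rw [integral_finsetSum _ fun i hi => hint _ (hS i hi), ← hfirst]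
    exact Finset.sum_congr rfl fun i hi => integral_indicator_one (hS i hi)
  have hsq : μ[N ^ 2] = ∑ i ∈ I, ∑ j ∈ I, μ.real (S i ∩ S j) := by
    have hN2 : N ^ 2 = fun ω => ∑ i ∈ I, ∑ j ∈ I, (S i ∩ S j).indicator (1 : Ω → ℝ) ω := by
      ext ω
      simp only [N, Pi.pow_apply, pow_two, Finset.sum_mul_sum, Set.inter_indicator_one,
        Pi.mul_apply]
    have hpair : ∀ i ∈ I, ∀ j ∈ I, MeasurableSet (S i ∩ S j) := fun i hi j hj =>
      (hS i hi).inter (hS j hj)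
    rw [hN2, integral_finsetSum _ fun i hi => integrable_finsetSum _ fun j hj =>
      hint _ (hpair i hi j hj)]
    refine Finset.sum_congr rfl fun i hi => ?_
    rw [integral_finsetSum _ fun j hj => hint _ (hpair i hi j hj)]
    exact Finset.sum_congr rfl fun j hj => integral_indicator_one (hpair i hi j hj)
  have hmem : MemLp N 2 μ :=
    memLp_finsetSum _ fun i hi => memLp_indicator_const 2 (hS i hi) (1 : ℝ) (Or.inr (by simp))
  simp only [hcard, ← hmean] at hM hsecond ⊢
  exact measureReal_le_half_integral_le hmem hM (hsq.trans_le hsecond)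

end SecondMomentMethod

section LinearFunctionals

open scoped Matrix

variable {ι : Type*} [Fintype ι]

lemma hasLaw_eval_pi_gaussianReal (i : ι) :
    HasLaw (fun J : ι → ℝ => J i) (gaussianReal 0 1) (Measure.pi fun _ => gaussianReal 0 1) :=
  (measurePreserving_eval (fun _ : ι => gaussianReal 0 1) i).hasLaw

lemma iIndepFun_eval_pi_gaussianReal :
    iIndepFun (fun i (J : ι → ℝ) => J i) (Measure.pi fun _ => gaussianReal 0 1) :=
  iIndepFun_pi (X := fun _ x => x) fun _ => by fun_prop

lemma hasGaussianLaw_dotProduct_pair (a b : ι → ℝ) :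
    HasGaussianLaw (fun J : ι → ℝ => (J ⬝ᵥ a, J ⬝ᵥ b)) (Measure.pi fun _ => gaussianReal 0 1) := by
  have hpi : HasGaussianLaw (fun J : ι → ℝ => fun i => J i)
      (Measure.pi fun _ => gaussianReal 0 1) :=
    iIndepFun_eval_pi_gaussianReal.hasGaussianLaw
      fun i => (hasLaw_eval_pi_gaussianReal i).hasGaussianLaw
  have hmap := hpi.map_fun
    ((∑ i, a i • ContinuousLinearMap.proj (R := ℝ) (φ := fun _ : ι => ℝ) i).prod
     (∑ i, b i • ContinuousLinearMap.proj (R := ℝ) (φ := fun _ : ι => ℝ) i))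
  simpa [dotProduct, mul_comm] using hmap

lemma covariance_eval_pi_gaussianReal [DecidableEq ι] (i j : ι) :
    cov[fun J : ι → ℝ => J i, fun J : ι → ℝ => J j; Measure.pi fun _ => gaussianReal 0 1] =
      if i = j then 1 else 0 := by
  split_ifs with hij
  · subst hij
    rw [covariance_self (hasLaw_eval_pi_gaussianReal i).aemeasurable,
      (hasLaw_eval_pi_gaussianReal i).variance_eq, variance_id_gaussianReal, NNReal.coe_one]
  · exact (iIndepFun_eval_pi_gaussianReal.indepFun hij).covariance_eq_zero
      (hasLaw_eval_pi_gaussianReal i).hasGaussianLaw.memLp_two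
      (hasLaw_eval_pi_gaussianReal j).hasGaussianLaw.memLp_two

lemma covariance_dotProduct_pi_gaussianReal (a b : ι → ℝ) :
    cov[fun J : ι → ℝ => J ⬝ᵥ a, fun J => J ⬝ᵥ b; Measure.pi fun _ => gaussianReal 0 1] =
      a ⬝ᵥ b := by
  classical
  have hmem : ∀ (c : ι → ℝ) (i : ι),
      MemLp (fun J : ι → ℝ => J i * c i) 2 (Measure.pi fun _ => gaussianReal 0 1) := fun c i =>
    (hasLaw_eval_pi_gaussianReal i).hasGaussianLaw.memLp_two.mul_const _
  simp only [dotProduct, covariance_fun_sum_fun_sum (hmem a) (hmem b), covariance_mul_const_left,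
    covariance_mul_const_right, covariance_eval_pi_gaussianReal]
  simp [mul_comm]

lemma hasLaw_dotProduct_pi_gaussianReal (a : ι → ℝ) :
    HasLaw (fun J : ι → ℝ => J ⬝ᵥ a) (gaussianReal 0 (a ⬝ᵥ a).toNNReal)
      (Measure.pi fun _ => gaussianReal 0 1) := by
  have hmean : ∫ J : ι → ℝ, J ⬝ᵥ a ∂(Measure.pi fun _ => gaussianReal 0 1) = 0 := by
    simp only [dotProduct]
    rw [integral_finsetSum _ fun i _ => ((hasLaw_eval_pi_gaussianReal i).hasGaussianLaw.memLp_two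
      |>.integrable one_le_two).mul_const _]
    refine Finset.sum_eq_zero fun i _ => ?_
    rw [integral_mul_const, (hasLaw_eval_pi_gaussianReal i).integral_eq, integral_id_gaussianReal,
      zero_mul]
  have hmeas : Measurable fun J : ι → ℝ => J ⬝ᵥ a := by simp only [dotProduct]; fun_prop
  refine ⟨hmeas.aemeasurable, ?_⟩
  rw [(hasGaussianLaw_dotProduct_pair a a).fst.map_eq_gaussianReal, hmean,
    ← covariance_self hmeas.aemeasurable, covariance_dotProduct_pi_gaussianReal]

end LinearFunctionals

section CorrelatedPair

/-- A bound for the ratio between the joint density of two centred Gaussian variables with common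
variance `v` and correlation `r` and the product of their densities, valid on `[-B, B]²` when
`a = B² / v`. -/
noncomputable def correlationFactor (a r : ℝ) : ℝ :=
  (√(1 - r ^ 2))⁻¹ * Real.exp (a * (|r| / (1 + |r|)))

lemma correlationFactor_nonneg (a r : ℝ) : 0 ≤ correlationFactor a r := by
  unfold correlationFactor; positivity

variable {B r : ℝ} {v : NNReal}

lemma sq_sub_sq_sub_mul_div_le {x y : ℝ} (hr : |r| < 1) (hx : |x| ≤ B) (hy : |y| ≤ B) :
    (y ^ 2 - (y - r * x) ^ 2 / (1 - r ^ 2)) / 2 ≤ B ^ 2 * (|r| / (1 + |r|)) := by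
  have hneg : 0 < 1 - |r| := by linarith
  have : 0 < 1 + |r| := by linarith [abs_nonneg r]
  have hfac : 1 - r ^ 2 = (1 - |r|) * (1 + |r|) := by rw [← sq_abs r]; ring
  have hr2 : 0 < 1 - r ^ 2 := by rw [hfac]; positivity
  have hcross : r * (x * y) ≤ |r| * (|x| * |y|) := by
    rw [← abs_mul, ← abs_mul]; exact le_abs_self _
  have hxy : |x| * |y| ≤ B ^ 2 := by
    rw [pow_two]; exact mul_le_mul hx hy (abs_nonneg _) ((abs_nonneg _).trans hx)
  have hnum : 2 * (r * (x * y)) - r ^ 2 * (x ^ 2 + y ^ 2) ≤ 2 * (1 - |r|) * |r| * B ^ 2 := by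
    rw [← sq_abs r, ← sq_abs x, ← sq_abs y]
    have := mul_le_mul_of_nonneg_left hxy (mul_nonneg hneg.le (abs_nonneg r))
    nlinarith [mul_nonneg (sq_nonneg |r|) (sq_nonneg (|x| - |y|))]
  calc (y ^ 2 - (y - r * x) ^ 2 / (1 - r ^ 2)) / 2
      = (2 * (r * (x * y)) - r ^ 2 * (x ^ 2 + y ^ 2)) / (2 * (1 - r ^ 2)) := by
        field_simp
        ring
    _ ≤ 2 * (1 - |r|) * |r| * B ^ 2 / (2 * (1 - r ^ 2)) := by gcongr
    _ = B ^ 2 * (|r| / (1 + |r|)) := by rw [hfac]; field_simp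

lemma gaussianPDFReal_le_correlationFactor_mul {x y : ℝ} (hr : |r| < 1) (hx : |x| ≤ B)
    (hy : |y| ≤ B) :
    gaussianPDFReal (r * x) (v * (1 - r ^ 2).toNNReal) y ≤
      correlationFactor (B ^ 2 / v) r * gaussianPDFReal 0 v y := by
  have hr2 : 0 < 1 - r ^ 2 := sub_pos.2 ((sq_lt_one_iff_abs_lt_one r).2 hr)
  have hexp : -(y - r * x) ^ 2 / (2 * (v * (1 - r ^ 2))) ≤
      B ^ 2 / v * (|r| / (1 + |r|)) + -(y - 0) ^ 2 / (2 * v) := by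
    have hdiv := div_le_div_of_nonneg_right (sq_sub_sq_sub_mul_div_le hr hx hy) v.coe_nonneg
    calc -(y - r * x) ^ 2 / (2 * (v * (1 - r ^ 2)))
        = (y ^ 2 - (y - r * x) ^ 2 / (1 - r ^ 2)) / 2 / v + -(y - 0) ^ 2 / (2 * v) := by
          generalize 1 - r ^ 2 = w
          ring
      _ ≤ B ^ 2 * (|r| / (1 + |r|)) / v + -(y - 0) ^ 2 / (2 * v) := by gcongr
      _ = _ := by ring
  unfold gaussianPDFReal correlationFactor
  rw [NNReal.coe_mul, Real.coe_toNNReal _ hr2.le, ← mul_assoc (2 * Real.pi),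
    Real.sqrt_mul (by positivity), mul_inv]
  calc (√(2 * Real.pi * v))⁻¹ * (√(1 - r ^ 2))⁻¹ *
        Real.exp (-(y - r * x) ^ 2 / (2 * (v * (1 - r ^ 2))))
      ≤ (√(2 * Real.pi * v))⁻¹ * (√(1 - r ^ 2))⁻¹ *
        Real.exp (B ^ 2 / v * (|r| / (1 + |r|)) + -(y - 0) ^ 2 / (2 * v)) := by gcongr
    _ = _ := by rw [Real.exp_add]; ring

lemma gaussianReal_le_correlationFactor_mul {x : ℝ} (hv : v ≠ 0) (hr : |r| < 1) (hx : |x| ≤ B)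
    {t : Set ℝ} (ht : MeasurableSet t) (htB : ∀ y ∈ t, |y| ≤ B) :
    gaussianReal (r * x) (v * (1 - r ^ 2).toNNReal) t ≤
      ENNReal.ofReal (correlationFactor (B ^ 2 / v) r) * gaussianReal 0 v t := by
  have hr2 : (1 - r ^ 2).toNNReal ≠ 0 := by
    simpa using (sq_lt_one_iff_abs_lt_one r).2 hr
  rw [gaussianReal_apply _ (mul_ne_zero hv hr2), gaussianReal_apply _ hv,
    ← lintegral_const_mul _ (by fun_prop)]
  refine setLIntegral_mono' ht fun y hy => ?_
  rw [gaussianPDF, gaussianPDF, ← ENNReal.ofReal_mul (correlationFactor_nonneg _ _)]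
  exact ENNReal.ofReal_le_ofReal (gaussianPDFReal_le_correlationFactor_mul hr hx (htB y hy))

variable {Ω : Type*} [MeasurableSpace Ω] {P : Measure Ω} {X Y : Ω → ℝ}

lemma hasLaw_prod_sub_mul_of_hasGaussianLaw (hX : HasLaw X (gaussianReal 0 v) P)
    (hY : HasLaw Y (gaussianReal 0 v) P) (hXY : HasGaussianLaw (fun ω => (X ω, Y ω)) P)
    (hcov : cov[X, Y; P] = r * v) :
    HasLaw (fun ω => (X ω, Y ω - r * X ω))
      ((gaussianReal 0 v).prod (gaussianReal 0 (v * (1 - r ^ 2).toNNReal))) P := by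
  have := hXY.isProbabilityMeasure
  have hXmem : MemLp X 2 P := hX.hasGaussianLaw.memLp_two
  have hYmem : MemLp Y 2 P := hY.hasGaussianLaw.memLp_two
  have hrXmem : MemLp (fun ω => r * X ω) 2 P := hXmem.const_mul r
  have hpair : HasGaussianLaw (fun ω => (X ω, Y ω - r * X ω)) P :=
    hXY.map_fun ((ContinuousLinearMap.fst ℝ ℝ ℝ).prod
      (ContinuousLinearMap.snd ℝ ℝ ℝ - r • ContinuousLinearMap.fst ℝ ℝ ℝ))
  have hvarX : cov[X, X; P] = v := by
    rw [covariance_self hX.aemeasurable, hX.variance_eq, variance_id_gaussianReal]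
  have hvarY : cov[Y, Y; P] = v := by
    rw [covariance_self hY.aemeasurable, hY.variance_eq, variance_id_gaussianReal]
  have hindep : IndepFun X (fun ω => Y ω - r * X ω) P := by
    refine hpair.indepFun_of_covariance_eq_zero ?_
    rw [covariance_fun_sub_right hXmem hYmem hrXmem, covariance_const_mul_right, hcov, hvarX,
      sub_self]
  have hmean : P[fun ω => Y ω - r * X ω] = 0 := by
    rw [integral_sub (hYmem.integrable one_le_two) (hrXmem.integrable one_le_two),
      integral_const_mul, hX.integral_eq, hY.integral_eq, integral_id_gaussianReal, mul_zero,
      sub_zero]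
  have hvar : Var[fun ω => Y ω - r * X ω; P] = v * (1 - r ^ 2) := by
    rw [← covariance_self hpair.snd.aemeasurable,
      covariance_fun_sub_fun_sub hYmem hrXmem hYmem hrXmem]
    simp only [covariance_const_mul_left, covariance_const_mul_right, covariance_comm Y X, hcov,
      hvarX, hvarY]
    ring
  refine ⟨hpair.aemeasurable, ?_⟩
  rw [(indepFun_iff_map_prod_eq_prod_map_map hX.aemeasurable hpair.snd.aemeasurable).1 hindep,
    hX.map_eq, hpair.snd.map_eq_gaussianReal, hmean, hvar, Real.toNNReal_mul v.coe_nonneg,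
    Real.toNNReal_coe]

lemma measure_mem_and_mem_le_correlationFactor_mul (hX : HasLaw X (gaussianReal 0 v) P)
    (hY : HasLaw Y (gaussianReal 0 v) P) (hXY : HasGaussianLaw (fun ω => (X ω, Y ω)) P)
    (hcov : cov[X, Y; P] = r * v) (hv : v ≠ 0) (hr : |r| < 1) {s t : Set ℝ}
    (hs : MeasurableSet s) (ht : MeasurableSet t) (hsB : ∀ x ∈ s, |x| ≤ B)
    (htB : ∀ y ∈ t, |y| ≤ B) :
    P {ω | X ω ∈ s ∧ Y ω ∈ t} ≤
      ENNReal.ofReal (correlationFactor (B ^ 2 / v) r) * gaussianReal 0 v t *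
        gaussianReal 0 v s := by
  set T : Set (ℝ × ℝ) := {q | q.1 ∈ s ∧ r * q.1 + q.2 ∈ t}
  have hT : MeasurableSet T :=
    (measurable_fst hs).inter ((by fun_prop : Measurable fun q : ℝ × ℝ => r * q.1 + q.2) ht)
  have hXW := hasLaw_prod_sub_mul_of_hasGaussianLaw hX hY hXY hcov
  have hset : {ω | X ω ∈ s ∧ Y ω ∈ t} = (fun ω => (X ω, Y ω - r * X ω)) ⁻¹' T := by
    ext ω
    simp [T]
  rw [hset, ← Measure.map_apply_of_aemeasurable hXW.aemeasurable hT, hXW.map_eq,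
    Measure.prod_apply hT, ← lintegral_indicator_const hs]
  refine lintegral_mono fun x => ?_
  by_cases hx : x ∈ s
  · have hsec : Prod.mk x ⁻¹' T = (fun w => r * x + w) ⁻¹' t := by ext w; simp [T, hx]
    rw [Set.indicator_of_mem hx, hsec, ← Measure.map_apply (by fun_prop) ht,
      gaussianReal_map_const_add, zero_add]
    exact gaussianReal_le_correlationFactor_mul hv hr (hsB x hx) ht htB
  · have hsec : Prod.mk x ⁻¹' T = ∅ := by ext w; simp [T, hx]
    rw [hsec, measure_empty]
    exact zero_le

end CorrelatedPair

lemma mul_volume_le_gaussianReal {b : ℝ} {v : NNReal} (hv : v ≠ 0) {s : Set ℝ}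
    (hs : MeasurableSet s) (hsb : ∀ x ∈ s, |x| ≤ b) :
    (√(2 * Real.pi * v))⁻¹ * Real.exp (-b ^ 2 / (2 * v)) * volume.real s ≤
      (gaussianReal 0 v).real s := by
  have hbdd : volume s ≠ ⊤ :=
    (Bornology.IsBounded.subset (Metric.isBounded_Icc (-b) b)
      fun x hx => abs_le.1 (hsb x hx)).measure_lt_top.ne
  rw [measureReal_def (gaussianReal 0 v), gaussianReal_apply_eq_integral _ hv,
    ENNReal.toReal_ofReal (setIntegral_nonneg hs fun x _ => gaussianPDFReal_nonneg _ _ _), mul_comm,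
    ← smul_eq_mul, ← setIntegral_const]
  refine setIntegral_mono_on (integrableOn_const hbdd)
    (integrable_gaussianPDFReal _ _).integrableOn hs fun x hx => ?_
  have hx2 : x ^ 2 ≤ b ^ 2 := sq_le_sq' (abs_le.1 (hsb x hx)).1 (abs_le.1 (hsb x hx)).2
  unfold gaussianPDFReal
  rw [sub_zero]
  gcongr

section Hypercube

variable {n : ℕ} {σ τ s : Fin n → ℝ}

lemma mem_hypercube : σ ∈ hypercube n ↔ ∀ j, σ j = -1 ∨ σ j = 1 := by
  simp [hypercube]

lemma card_hypercube (n : ℕ) : (hypercube n).card = 2 ^ n := by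
  rw [hypercube, Fintype.card_piFinset_const, Finset.card_pair (by norm_num)]

lemma mul_self_of_mem_hypercube (hσ : σ ∈ hypercube n) : σ * σ = 1 := by
  ext j
  rcases mem_hypercube.1 hσ j with h | h <;> simp [h]

lemma mul_mem_hypercube (hσ : σ ∈ hypercube n) (hτ : τ ∈ hypercube n) : σ * τ ∈ hypercube n := by
  refine mem_hypercube.2 fun j => ?_
  rcases mem_hypercube.1 hσ j with h | h <;> rcases mem_hypercube.1 hτ j with h' | h' <;>
    simp [h, h']

lemma sum_hypercube_mul {M : Type*} [AddCommMonoid M] (hσ : σ ∈ hypercube n)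
    (F : (Fin n → ℝ) → M) : ∑ τ ∈ hypercube n, F (σ * τ) = ∑ s ∈ hypercube n, F s := by
  have hinv : ∀ s, σ * (σ * s) = s := fun s => by
    rw [← mul_assoc, mul_self_of_mem_hypercube hσ, one_mul]
  exact Finset.sum_nbij' (fun τ => σ * τ) (fun s => σ * s)
    (fun τ hτ => mul_mem_hypercube hσ hτ) (fun s hs => mul_mem_hypercube hσ hs)
    (fun τ _ => hinv τ) (fun s _ => hinv s) (fun _ _ => rfl)

/-- The magnetization of a configuration. The overlap of `σ` and `τ` is the magnetization of
`σ * τ`. -/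
noncomputable def magnetization (s : Fin n → ℝ) : ℝ := (∑ j, s j) / n

lemma natCast_mul_magnetization (s : Fin n → ℝ) : n * magnetization s = ∑ j, s j := by
  rcases eq_or_ne n 0 with rfl | hn
  · simp
  · exact mul_div_cancel₀ _ (Nat.cast_ne_zero.2 hn)

lemma sum_hypercube_exp_mul_magnetization (n : ℕ) (l : ℝ) :
    ∑ s ∈ hypercube n, Real.exp (l * (n * magnetization s)) = (2 * Real.cosh l) ^ n := by
  simp only [natCast_mul_magnetization, Finset.mul_sum, Real.exp_sum]
  rw [hypercube, Finset.sum_prod_piFinset (g := fun _ x => Real.exp (l * x))]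
  simp only [Finset.prod_const, Finset.card_univ, Fintype.card_fin]
  rw [Finset.sum_pair (by norm_num), Real.cosh_eq]
  ring_nf

lemma exists_natCast_mul_magnetization_eq (hs : s ∈ hypercube n) :
    ∃ k ≤ n, (n : ℝ) * magnetization s = n - 2 * k := by
  classical
  refine ⟨(Finset.univ.filter fun j => s j = -1).card,
    (Finset.card_le_univ _).trans_eq (Fintype.card_fin n), ?_⟩
  have hentry : ∀ j, s j = 1 - 2 * (if s j = -1 then 1 else 0) := fun j => by
    rcases mem_hypercube.1 hs j with h | h <;> rw [h] <;> norm_num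
  rw [natCast_mul_magnetization, Finset.sum_congr rfl fun j _ => hentry j,
    Finset.sum_sub_distrib, ← Finset.mul_sum]
  simp

lemma one_le_mul_one_sub_abs_magnetization (hn : n ≠ 0) (hs : s ∈ hypercube n)
    (hm : |magnetization s| ≠ 1) : 1 ≤ n * (1 - |magnetization s|) := by
  obtain ⟨k, hkn, hk⟩ := exists_natCast_mul_magnetization_eq hs
  have hn0 : (n : ℝ) ≠ 0 := Nat.cast_ne_zero.2 hn
  have hk0 : k ≠ 0 := by
    rintro rfl
    have : magnetization s = 1 := by simpa [hn0] using hk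
    exact hm (by rw [this, abs_one])
  have hkn' : k ≠ n := by
    rintro rfl
    have : magnetization s = -1 := mul_left_cancel₀ hn0 (by linarith)
    exact hm (by rw [this, abs_neg, abs_one])
  have hk_pos : (1 : ℝ) ≤ k := by exact_mod_cast Nat.one_le_iff_ne_zero.2 hk0
  have hk_lt : (k : ℝ) + 1 ≤ n := by exact_mod_cast lt_of_le_of_ne hkn hkn'
  have habs : |(n : ℝ) * magnetization s| ≤ n - 1 := by
    rw [hk, abs_le]
    constructor <;> linarith
  rw [abs_mul, Nat.abs_cast] at habs
  linarith

lemma eq_one_of_magnetization_eq_one (hs : s ∈ hypercube n) (hm : magnetization s = 1) :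
    s = 1 := by
  have hle : ∀ j ∈ Finset.univ, s j ≤ 1 := fun j _ => by
    rcases mem_hypercube.1 hs j with h | h <;> norm_num [h]
  have hsum : ∑ j, s j = ∑ _j : Fin n, (1 : ℝ) := by
    rw [← natCast_mul_magnetization, hm]
    simp
  exact funext fun j => (Finset.sum_eq_sum_iff_of_le hle).1 hsum j (Finset.mem_univ j)

lemma card_abs_magnetization_eq_one_le (n : ℕ) :
    ((hypercube n).filter fun s => |magnetization s| = 1).card ≤ 2 := by
  have hsub : ((hypercube n).filter fun s => |magnetization s| = 1) ⊆ {1, -1} := fun s hs => by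
    obtain ⟨hs, hm⟩ := Finset.mem_filter.1 hs
    rw [Finset.mem_insert, Finset.mem_singleton]
    rcases eq_or_eq_neg_of_abs_eq hm with hm | hm
    · exact Or.inl (eq_one_of_magnetization_eq_one hs hm)
    · have hneg : -s ∈ hypercube n :=
        mem_hypercube.2 fun j => (mem_hypercube.1 hs j).symm.imp (by simp +contextual)
          (by simp +contextual)
      have hmneg : magnetization (-s) = 1 := by
        simp only [magnetization, Pi.neg_apply, Finset.sum_neg_distrib, neg_div]
        rw [← magnetization, hm, neg_neg]
      exact Or.inr (neg_eq_iff_eq_neg.1 (eq_one_of_magnetization_eq_one hneg hmneg))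
  exact (Finset.card_le_card hsub).trans Finset.card_le_two

lemma sum_hypercube_exp_magnetization_sq_le (n : ℕ) :
    ∑ s ∈ hypercube n, Real.exp (n * magnetization s ^ 2 / 2) ≤ (n + 1) * 2 ^ n := by
  classical
  set V : Finset ℝ := (Finset.range (n + 1)).image fun k : ℕ => ((n : ℝ) - 2 * k) / n
  have hmem : ∀ s ∈ hypercube n, magnetization s ∈ V := fun s hs => by
    obtain ⟨k, hkn, hk⟩ := exists_natCast_mul_magnetization_eq hs
    refine Finset.mem_image.2 ⟨k, Finset.mem_range.2 (Nat.lt_succ_of_le hkn), ?_⟩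
    rw [← hk, natCast_mul_magnetization, magnetization]
  have hcard : (V.card : ℝ) ≤ n + 1 := by
    exact_mod_cast Finset.card_image_le.trans_eq (Finset.card_range _)
  -- The Chernoff exponent `n (x m - x² / 2)` is largest at `x = m`, where it equals `n m² / 2`.
  calc ∑ s ∈ hypercube n, Real.exp (n * magnetization s ^ 2 / 2)
      ≤ ∑ s ∈ hypercube n, ∑ x ∈ V,
          Real.exp (-(n * (x ^ 2 / 2))) * Real.exp (x * (n * magnetization s)) := by
        refine Finset.sum_le_sum fun s hs => ?_
        refine le_of_eq_of_le ?_ (Finset.single_le_sum (fun x _ => by positivity) (hmem s hs))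
        rw [← Real.exp_add]
        ring_nf
    _ = ∑ x ∈ V, Real.exp (-(n * (x ^ 2 / 2))) * (2 * Real.cosh x) ^ n := by
        rw [Finset.sum_comm]
        simp only [← Finset.mul_sum, sum_hypercube_exp_mul_magnetization]
    _ ≤ ∑ _x ∈ V, (2 : ℝ) ^ n := by
        refine Finset.sum_le_sum fun x _ => ?_
        calc Real.exp (-(n * (x ^ 2 / 2))) * (2 * Real.cosh x) ^ n
            ≤ Real.exp (-(n * (x ^ 2 / 2))) * (2 * Real.exp (x ^ 2 / 2)) ^ n := by
              gcongr
              exact Real.cosh_le_exp_half_sq x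
          _ = 2 ^ n := by
              rw [mul_pow, ← Real.exp_nat_mul, mul_left_comm, ← Real.exp_add, neg_add_cancel,
                Real.exp_zero, mul_one]
    _ ≤ (n + 1) * 2 ^ n := by
        rw [Finset.sum_const, nsmul_eq_mul]
        gcongr

lemma card_le_abs_magnetization_le (n : ℕ) {l : ℝ} (r : ℝ) (hl : 0 ≤ l) :
    (((hypercube n).filter fun s => r ≤ |magnetization s|).card : ℝ) ≤
      2 * Real.exp ((Real.exp (-2 * l) + l * (1 - r)) * n) := by
  have hchernoff : (((hypercube n).filter fun s => r ≤ |magnetization s|).card : ℝ) *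
      Real.exp (l * (n * r)) ≤ 2 * (2 * Real.cosh l) ^ n := by
    calc (((hypercube n).filter fun s => r ≤ |magnetization s|).card : ℝ) * Real.exp (l * (n * r))
        = ∑ s ∈ hypercube n with r ≤ |magnetization s|, Real.exp (l * (n * r)) := by
          rw [Finset.sum_const, nsmul_eq_mul]
      _ ≤ ∑ s ∈ hypercube n with r ≤ |magnetization s|,
            (Real.exp (l * (n * magnetization s)) + Real.exp (-l * (n * magnetization s))) := by
          refine Finset.sum_le_sum fun s hs => ?_
          calc Real.exp (l * (n * r)) ≤ Real.exp |l * (n * magnetization s)| := by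
                rw [abs_mul, abs_mul, abs_of_nonneg hl, Nat.abs_cast]
                gcongr
                exact (Finset.mem_filter.1 hs).2
            _ ≤ _ := by
                rw [neg_mul]
                exact Real.exp_abs_le _
      _ ≤ ∑ s ∈ hypercube n,
            (Real.exp (l * (n * magnetization s)) + Real.exp (-l * (n * magnetization s))) :=
          Finset.sum_le_sum_of_subset_of_nonneg (Finset.filter_subset _ _)
            fun _ _ _ => by positivity
      _ = 2 * (2 * Real.cosh l) ^ n := by
          rw [Finset.sum_add_distrib, sum_hypercube_exp_mul_magnetization,
            sum_hypercube_exp_mul_magnetization, Real.cosh_neg, ← two_mul]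
  have hcosh : 2 * Real.cosh l ≤ Real.exp (l + Real.exp (-2 * l)) := by
    have hneg : Real.exp (-l) = Real.exp l * Real.exp (-2 * l) := by
      rw [← Real.exp_add]; ring_nf
    calc 2 * Real.cosh l = Real.exp l * (Real.exp (-2 * l) + 1) := by
          rw [Real.cosh_eq, hneg]; ring
      _ ≤ Real.exp l * Real.exp (Real.exp (-2 * l)) := by
          gcongr
          exact Real.add_one_le_exp _
      _ = _ := (Real.exp_add _ _).symm
  refine le_of_mul_le_mul_right (hchernoff.trans ?_) (Real.exp_pos (l * (n * r)))
  calc 2 * (2 * Real.cosh l) ^ n ≤ 2 * Real.exp (l + Real.exp (-2 * l)) ^ n := by gcongr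
    _ = _ := by
        rw [← Real.exp_nat_mul, mul_assoc, ← Real.exp_add]
        ring_nf

lemma exists_card_le_abs_magnetization_le {g : ℝ} (hg : 0 < g) :
    ∃ r : ℝ, 0 < r ∧ r < 1 ∧ ∀ n : ℕ,
      (((hypercube n).filter fun s => r ≤ |magnetization s|).card : ℝ) ≤ 2 * Real.exp (g * n) := by
  obtain ⟨l, hl0, hl⟩ : ∃ l : ℝ, 0 < l ∧ Real.exp (-2 * l) < g / 2 := by
    have hlim : Tendsto (fun l : ℝ => Real.exp (-2 * l)) atTop (𝓝 0) :=
      Real.tendsto_exp_atBot.comp (tendsto_id.const_mul_atTop_of_neg (by norm_num))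
    exact ((eventually_gt_atTop 0).and (hlim.eventually_lt_const (half_pos hg))).exists
  refine ⟨max (1 / 2) (1 - g / 2 / l), lt_max_of_lt_left (by norm_num),
    max_lt (by norm_num) (sub_lt_self 1 (by positivity)), fun n =>
    (card_le_abs_magnetization_le n _ hl0.le).trans ?_⟩
  have hlr : l * (1 - max (1 / 2) (1 - g / 2 / l)) ≤ g / 2 :=
    calc l * (1 - max (1 / 2) (1 - g / 2 / l)) ≤ l * (1 - (1 - g / 2 / l)) := by
          gcongr
          exact le_max_right _ _
      _ = g / 2 := by field_simp; ring
  gcongr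
  linarith

end Hypercube

section OverlapRegimes

variable {a b e r x : ℝ} {n p : ℕ}

lemma correlationFactor_le_of_abs_le (ha : 0 ≤ a) (hr : |r| ≤ e) (he : e < 1) :
    correlationFactor a r ≤ (√(1 - e ^ 2))⁻¹ * Real.exp (a * e) := by
  have he0 : 0 ≤ e := (abs_nonneg r).trans hr
  have he2 : 0 < 1 - e ^ 2 := by nlinarith
  have hsq : r ^ 2 ≤ e ^ 2 := sq_le_sq' (abs_le.1 hr).1 (abs_le.1 hr).2
  unfold correlationFactor
  gcongr
  exact (div_le_self (abs_nonneg r) (by linarith [abs_nonneg r])).trans hr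

lemma correlationFactor_le_sqrt_mul (hn : 1 ≤ n * (1 - |r|)) :
    correlationFactor a r ≤ √n * Real.exp (a * (|r| / (1 + |r|))) := by
  have hr : 0 < 1 - |r| := pos_of_mul_pos_right (by linarith) n.cast_nonneg
  have hr2 : 1 - |r| ≤ 1 - r ^ 2 := by
    rw [← sq_abs]
    nlinarith [abs_nonneg r]
  unfold correlationFactor
  gcongr
  rw [inv_le_iff_one_le_mul₀ (Real.sqrt_pos.2 (hr.trans_le hr2)),
    ← Real.sqrt_mul n.cast_nonneg, Real.one_le_sqrt]
  exact hn.trans (by gcongr)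

lemma correlationFactor_le_sqrt_mul_exp_half (ha : 0 ≤ a) (hn : 1 ≤ n * (1 - |r|)) :
    correlationFactor a r ≤ √n * Real.exp (a / 2) := by
  have hr : 0 < 1 - |r| := pos_of_mul_pos_right (by linarith) n.cast_nonneg
  have hhalf : |r| / (1 + |r|) ≤ 1 / 2 := by
    rw [div_le_div_iff₀ (by positivity) two_pos]
    linarith
  calc correlationFactor a r ≤ √n * Real.exp (a * (|r| / (1 + |r|))) :=
        correlationFactor_le_sqrt_mul hn
    _ ≤ √n * Real.exp (a * (1 / 2)) := by gcongr
    _ = √n * Real.exp (a / 2) := by rw [mul_one_div]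

lemma correlationFactor_pow_le_mul_exp_sq (hr : b ^ 2 * r ^ p ≤ 1 / 4) (hxr : |x| ≤ r)
    (hnx : √n ≤ n * x ^ 2) (hn : 1 ≤ n * (1 - |x ^ (p + 2)|)) :
    correlationFactor (b ^ 2 * n) (x ^ (p + 2)) ≤
      √n * Real.exp (-(√n / 4)) * Real.exp (n * x ^ 2 / 2) := by
  have hexp : b ^ 2 * n * (|x ^ (p + 2)| / (1 + |x ^ (p + 2)|)) ≤ -(√n / 4) + n * x ^ 2 / 2 :=
    calc b ^ 2 * n * (|x ^ (p + 2)| / (1 + |x ^ (p + 2)|))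
        ≤ b ^ 2 * n * |x ^ (p + 2)| := by
          gcongr
          exact div_le_self (abs_nonneg _) (by linarith [abs_nonneg (x ^ (p + 2))])
      _ = n * x ^ 2 * (b ^ 2 * |x| ^ p) := by
          rw [abs_pow, pow_add, sq_abs]
          ring
      _ ≤ n * x ^ 2 * (1 / 4) := by
          gcongr
          exact le_trans (by gcongr) hr
      _ ≤ -(√n / 4) + n * x ^ 2 / 2 := by linarith
  calc correlationFactor (b ^ 2 * n) (x ^ (p + 2))
      ≤ √n * Real.exp (b ^ 2 * n * (|x ^ (p + 2)| / (1 + |x ^ (p + 2)|))) :=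
        correlationFactor_le_sqrt_mul hn
    _ ≤ √n * Real.exp (-(√n / 4) + n * x ^ 2 / 2) := by gcongr
    _ = _ := by rw [Real.exp_add, mul_assoc]

lemma natCast_mul_inv_sqrt_sqrt_sq (n : ℕ) : n * (√√(n : ℝ))⁻¹ ^ 2 = √n := by
  rw [inv_pow, Real.sq_sqrt (Real.sqrt_nonneg _), ← div_eq_mul_inv, Real.div_sqrt]

lemma natCast_mul_inv_sqrt_sqrt_pow_five (hn : n ≠ 0) :
    n * (√√(n : ℝ))⁻¹ ^ 5 = (√√(n : ℝ))⁻¹ := by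
  have hsqrt : √(n : ℝ) ≠ 0 := Real.sqrt_ne_zero'.2 (by exact_mod_cast Nat.pos_of_ne_zero hn)
  calc n * (√√(n : ℝ))⁻¹ ^ 5 = n * (√√(n : ℝ))⁻¹ ^ 2 * (√√(n : ℝ))⁻¹ ^ 2 * (√√(n : ℝ))⁻¹ := by ring
    _ = (√√(n : ℝ))⁻¹ := by
      rw [natCast_mul_inv_sqrt_sqrt_sq, inv_pow, Real.sq_sqrt (Real.sqrt_nonneg _),
        mul_inv_cancel₀ hsqrt, one_mul]

lemma inv_sqrt_sqrt_natCast_lt_one (hn : 2 ≤ n) : (√√(n : ℝ))⁻¹ < 1 := by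
  have hn1 : (1 : ℝ) < n := by exact_mod_cast hn
  exact inv_lt_one_of_one_lt₀
    (Real.lt_sqrt_of_sq_lt (by simpa using Real.lt_sqrt_of_sq_lt (by simpa using hn1)))

lemma correlationFactor_magnetization_pow_le {s : Fin n → ℝ} (hn : 2 ≤ n) (hp : 3 ≤ p)
    (hr : b ^ 2 * r ^ p ≤ 1 / 4) (hs : s ∈ hypercube n) (hm : |magnetization s| ≠ 1) :
    correlationFactor (b ^ 2 * n) (magnetization s ^ (p + 2)) ≤
      (√(1 - ((√√n)⁻¹ ^ 5) ^ 2))⁻¹ * Real.exp (b ^ 2 * (√√n)⁻¹) +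
      √n * Real.exp (-(√n / 4)) * Real.exp (n * magnetization s ^ 2 / 2) +
      (if r ≤ |magnetization s| then √n * Real.exp (b ^ 2 * n / 2) else 0) := by
  have hgap := one_le_mul_one_sub_abs_magnetization (by omega) hs hm
  set x := magnetization s
  have : (0 : ℝ) < n := by exact_mod_cast (by omega : 0 < n)
  set e : ℝ := (√√n)⁻¹
  have hx1 : |x| < 1 := by nlinarith
  have hgap_pow : 1 ≤ n * (1 - |x ^ (p + 2)|) := by
    rw [abs_pow]
    refine hgap.trans ?_
    gcongr
    exact pow_le_of_le_one (abs_nonneg x) hx1.le (by omega)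
  have he0 : 0 < e := by positivity
  have he1 : e < 1 := inv_sqrt_sqrt_natCast_lt_one hn
  have hsmall_nonneg : 0 ≤ (√(1 - (e ^ 5) ^ 2))⁻¹ * Real.exp (b ^ 2 * e) := by positivity
  have hmid_nonneg : 0 ≤ √n * Real.exp (-(√n / 4)) * Real.exp (n * x ^ 2 / 2) := by positivity
  have hbig_nonneg : 0 ≤ if r ≤ |x| then √n * Real.exp (b ^ 2 * n / 2) else 0 := by positivity
  -- At `e = n ^ (-1/4)`: below it the correlation is at most `n ^ (-5/4)`, negligible against the
  -- exponent `b ^ 2 * n`; above it `n * x ^ 2 ≥ √n` leaves room for the gain `exp (-√n / 4)`.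
  rcases le_or_gt |x| e with hxe | hxe
  · have hpow : |x ^ (p + 2)| ≤ e ^ 5 := by
      rw [abs_pow]
      exact (pow_le_pow_left₀ (abs_nonneg x) hxe _).trans
        (pow_le_pow_of_le_one he0.le he1.le (by omega))
    have hsmall := correlationFactor_le_of_abs_le (a := b ^ 2 * n) (by positivity) hpow
      (pow_lt_one₀ he0.le he1 (by norm_num))
    rw [mul_assoc, natCast_mul_inv_sqrt_sqrt_pow_five (by omega)] at hsmall
    linarith
  rcases le_or_gt r |x| with hrx | hrx
  · rw [if_pos hrx]
    linarith [correlationFactor_le_sqrt_mul_exp_half (a := b ^ 2 * n) (by positivity) hgap_pow]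
  · have hnx : √n ≤ n * x ^ 2 := by
      rw [← natCast_mul_inv_sqrt_sqrt_sq, ← sq_abs x]
      gcongr
    linarith [correlationFactor_pow_le_mul_exp_sq hr hrx.le hnx hgap_pow]

lemma sum_correlationFactor_magnetization_pow_le {g : ℝ} (hn : 2 ≤ n) (hp : 3 ≤ p)
    (hr : b ^ 2 * r ^ p ≤ 1 / 4)
    (hcard : (((hypercube n).filter fun s => r ≤ |magnetization s|).card : ℝ) ≤
      2 * Real.exp (g * n)) :
    ∑ s ∈ hypercube n with |magnetization s| ≠ 1,
        correlationFactor (b ^ 2 * n) (magnetization s ^ (p + 2)) ≤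
      ((√(1 - ((√√n)⁻¹ ^ 5) ^ 2))⁻¹ * Real.exp (b ^ 2 * (√√n)⁻¹) +
        (n + 1) * (√n * Real.exp (-(√n / 4))) +
        2 * (√n * Real.exp (-(Real.log 2 - b ^ 2 / 2 - g) * n))) * 2 ^ n := by
  set A := (√(1 - ((√√n)⁻¹ ^ 5) ^ 2))⁻¹ * Real.exp (b ^ 2 * (√√n)⁻¹)
  set B := √n * Real.exp (-(√n / 4))
  have hexp : Real.exp (g * n) * Real.exp (b ^ 2 * n / 2) =
      Real.exp (-(Real.log 2 - b ^ 2 / 2 - g) * n) * 2 ^ n := by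
    rw [← Real.exp_log (two_pos : (0 : ℝ) < 2), ← Real.exp_nat_mul, Real.exp_log two_pos,
      ← Real.exp_add, ← Real.exp_add]
    ring_nf
  calc ∑ s ∈ hypercube n with |magnetization s| ≠ 1,
        correlationFactor (b ^ 2 * n) (magnetization s ^ (p + 2))
      ≤ ∑ s ∈ hypercube n with |magnetization s| ≠ 1, (A +
          B * Real.exp (n * magnetization s ^ 2 / 2) +
          if r ≤ |magnetization s| then √n * Real.exp (b ^ 2 * n / 2) else 0) := by
        refine Finset.sum_le_sum fun s hs => ?_
        obtain ⟨hs, hm⟩ := Finset.mem_filter.1 hs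
        exact correlationFactor_magnetization_pow_le hn hp hr hs hm
    _ ≤ ∑ s ∈ hypercube n, (A + B * Real.exp (n * magnetization s ^ 2 / 2) +
          if r ≤ |magnetization s| then √n * Real.exp (b ^ 2 * n / 2) else 0) :=
        Finset.sum_le_sum_of_subset_of_nonneg (Finset.filter_subset _ _)
          fun _ _ _ => by positivity
    _ = 2 ^ n * A + B * ∑ s ∈ hypercube n, Real.exp (n * magnetization s ^ 2 / 2) +
          ((hypercube n).filter fun s => r ≤ |magnetization s|).card *
            (√n * Real.exp (b ^ 2 * n / 2)) := by
        rw [Finset.sum_add_distrib, Finset.sum_add_distrib, Finset.sum_const, card_hypercube,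
          ← Finset.mul_sum, ← Finset.sum_filter, Finset.sum_const, nsmul_eq_mul, nsmul_eq_mul,
          Nat.cast_pow, Nat.cast_ofNat]
    _ ≤ 2 ^ n * A + B * ((n + 1) * 2 ^ n) +
          2 * Real.exp (g * n) * (√n * Real.exp (b ^ 2 * n / 2)) := by
        gcongr
        exact sum_hypercube_exp_magnetization_sq_le n
    _ = _ := by linear_combination 2 * √n * hexp

lemma tendsto_smallOverlapBound (b : ℝ) :
    Tendsto (fun n : ℕ =>
      (√(1 - ((√√(n : ℝ))⁻¹ ^ 5) ^ 2))⁻¹ * Real.exp (b ^ 2 * (√√(n : ℝ))⁻¹)) atTop (𝓝 1) := by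
  have he : Tendsto (fun n : ℕ => (√√(n : ℝ))⁻¹) atTop (𝓝 0) :=
    tendsto_inv_atTop_zero.comp (Real.tendsto_sqrt_atTop.comp
      (Real.tendsto_sqrt_atTop.comp tendsto_natCast_atTop_atTop))
  have hcont : ContinuousAt
      (fun x : ℝ => (√(1 - (x ^ 5) ^ 2))⁻¹ * Real.exp (b ^ 2 * x)) 0 :=
    ContinuousAt.mul (ContinuousAt.inv₀ (by fun_prop) (by simp)) (by fun_prop)
  simpa [Function.comp_def] using hcont.tendsto.comp he

lemma tendsto_middleOverlapBound :
    Tendsto (fun n : ℕ => ((n : ℝ) + 1) * (√n * Real.exp (-(√n / 4)))) atTop (𝓝 0) := by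
  have hpow : ∀ k : ℕ, Tendsto (fun n : ℕ => √(n : ℝ) ^ k * Real.exp (-(√n / 4))) atTop (𝓝 0) := by
    intro k
    have h := (tendsto_rpow_mul_exp_neg_mul_atTop_nhds_zero k (1 / 4) (by norm_num)).comp
      (Real.tendsto_sqrt_atTop.comp (tendsto_natCast_atTop_atTop (R := ℝ)))
    refine h.congr fun n => ?_
    simp only [Function.comp_apply, Real.rpow_natCast]
    ring_nf
  have hsum := (hpow 3).add (hpow 1)
  rw [add_zero] at hsum
  refine hsum.congr fun n => ?_
  linear_combination (√n * Real.exp (-(√n / 4))) * Real.sq_sqrt (Nat.cast_nonneg (α := ℝ) n)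

lemma tendsto_largeOverlapBound {g : ℝ} (hg : 0 < g) :
    Tendsto (fun n : ℕ => 2 * (√(n : ℝ) * Real.exp (-g * n))) atTop (𝓝 0) := by
  have h := ((tendsto_rpow_mul_exp_neg_mul_atTop_nhds_zero (1 / 2) g hg).comp
    (tendsto_natCast_atTop_atTop (R := ℝ))).const_mul 2
  simpa [Function.comp_def, Real.sqrt_eq_rpow] using h

lemma exists_eventually_sum_correlationFactor_le (hb : b ^ 2 / 2 < Real.log 2) :
    ∃ P : ℕ, ∀ p ≥ P, ∀ ε > 0, ∀ᶠ n : ℕ in atTop,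
      ∑ s ∈ hypercube n with |magnetization s| ≠ 1,
        correlationFactor (b ^ 2 * n) (magnetization s ^ p) ≤ (1 + ε) * 2 ^ n := by
  set g : ℝ := (Real.log 2 - b ^ 2 / 2) / 2 with hg
  have hg0 : 0 < Real.log 2 - b ^ 2 / 2 - g := by linarith
  obtain ⟨r, hr0, hr1, hcard⟩ := exists_card_le_abs_magnetization_le (g := g) (by linarith)
  obtain ⟨P, hP⟩ : ∃ P : ℕ, ∀ p ≥ P, b ^ 2 * r ^ p ≤ 1 / 4 := by
    have hlim := (tendsto_pow_atTop_nhds_zero_of_lt_one hr0.le hr1).const_mul (b ^ 2)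
    rw [mul_zero] at hlim
    exact eventually_atTop.1 (hlim.eventually_le_const (by norm_num))
  refine ⟨P + 5, fun p hp ε hε => ?_⟩
  obtain ⟨q, rfl⟩ := Nat.exists_eq_add_of_le' (show 2 ≤ p by omega)
  have hlim := ((tendsto_smallOverlapBound b).add tendsto_middleOverlapBound).add
    (tendsto_largeOverlapBound hg0)
  rw [add_zero, add_zero] at hlim
  filter_upwards [hlim.eventually_le_const (lt_add_of_pos_right 1 hε), eventually_ge_atTop 2]
    with n hbound hn
  refine (sum_correlationFactor_magnetization_pow_le hn (by omega) (hP q (by omega))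
    (hcard n)).trans ?_
  gcongr

end OverlapRegimes

section Hamiltonian

open scoped Matrix

variable {n p : ℕ}

instance : IsProbabilityMeasure (disorder n p) := by unfold disorder; infer_instance

/-- The coefficients of `H(σ)` as a linear functional of the disorder. -/
noncomputable def spinVector (p : ℕ) (σ : Fin n → ℝ) (i : Fin p → Fin n) : ℝ :=
  (n : ℝ) ^ (-((p : ℝ) + 1) / 2) * ∏ k, σ (i k)

lemma hamiltonian_eq_dotProduct (J : Tensor n p) (σ : Fin n → ℝ) :
    hamiltonian J σ = J ⬝ᵥ spinVector p σ := by
  simp only [hamiltonian, dotProduct, spinVector, Finset.mul_sum, mul_left_comm]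

lemma spinVector_dotProduct_spinVector (σ τ : Fin n → ℝ) :
    spinVector p σ ⬝ᵥ spinVector p τ = magnetization (σ * τ) ^ p * (n : ℝ)⁻¹ := by
  have hscale : (n : ℝ) ^ (-((p : ℝ) + 1) / 2) * (n : ℝ) ^ (-((p : ℝ) + 1) / 2) =
      ((n : ℝ) ^ p)⁻¹ * (n : ℝ)⁻¹ := by
    rw [← pow_two, ← Real.rpow_natCast, ← Real.rpow_mul n.cast_nonneg, Nat.cast_ofNat,
      div_mul_cancel₀ _ two_ne_zero, Real.rpow_neg n.cast_nonneg, ← Nat.cast_succ,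
      Real.rpow_natCast, pow_succ, mul_inv]
  simp only [dotProduct, spinVector, mul_mul_mul_comm, hscale, ← Finset.prod_mul_distrib]
  rw [← Finset.mul_sum, ← Fintype.sum_pow fun j => σ j * τ j, magnetization, div_pow]
  simp only [Pi.mul_apply]
  ring

lemma measurable_hamiltonian (σ : Fin n → ℝ) :
    Measurable fun J : Tensor n p => hamiltonian J σ := by
  unfold hamiltonian; fun_prop

lemma hasGaussianLaw_hamiltonian_pair (σ τ : Fin n → ℝ) :
    HasGaussianLaw (fun J : Tensor n p => (hamiltonian J σ, hamiltonian J τ)) (disorder n p) := by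
  simp only [hamiltonian_eq_dotProduct]
  exact hasGaussianLaw_dotProduct_pair _ _

lemma covariance_hamiltonian (σ τ : Fin n → ℝ) :
    cov[fun J : Tensor n p => hamiltonian J σ, fun J => hamiltonian J τ; disorder n p] =
      magnetization (σ * τ) ^ p * (n : ℝ)⁻¹ := by
  simp only [hamiltonian_eq_dotProduct]
  rw [disorder, covariance_dotProduct_pi_gaussianReal, spinVector_dotProduct_spinVector]

variable {σ τ : Fin n → ℝ}

lemma hasLaw_hamiltonian (hσ : σ ∈ hypercube n) :
    HasLaw (fun J : Tensor n p => hamiltonian J σ) (gaussianReal 0 (n : NNReal)⁻¹)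
      (disorder n p) := by
  have hself : spinVector p σ ⬝ᵥ spinVector p σ = (n : ℝ)⁻¹ := by
    rw [spinVector_dotProduct_spinVector, mul_self_of_mem_hypercube hσ]
    rcases eq_or_ne n 0 with rfl | hn
    · simp
    · simp [magnetization, hn]
  have hlaw := hasLaw_dotProduct_pi_gaussianReal (spinVector p σ)
  rw [hself, Real.toNNReal_inv, Real.toNNReal_natCast] at hlaw
  simpa only [hamiltonian_eq_dotProduct, disorder] using hlaw

variable {s : Set ℝ} {b : ℝ}

lemma measureReal_hamiltonian_mem (hσ : σ ∈ hypercube n) (hs : MeasurableSet s) :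
    (disorder n p).real {J | hamiltonian J σ ∈ s} = (gaussianReal 0 (n : NNReal)⁻¹).real s :=
  (hasLaw_hamiltonian hσ).measureReal_eq hs

lemma measureReal_hamiltonian_mem_and_mem_le (hn : n ≠ 0) (hp : p ≠ 0) (hσ : σ ∈ hypercube n)
    (hτ : τ ∈ hypercube n) (hm : |magnetization (σ * τ)| ≠ 1) (hs : MeasurableSet s)
    (hsb : ∀ x ∈ s, |x| ≤ b) :
    (disorder n p).real {J | hamiltonian J σ ∈ s ∧ hamiltonian J τ ∈ s} ≤
      (gaussianReal 0 (n : NNReal)⁻¹).real s ^ 2 *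
        correlationFactor (b ^ 2 * n) (magnetization (σ * τ) ^ p) := by
  have hm1 : |magnetization (σ * τ)| < 1 := by
    have hgap := one_le_mul_one_sub_abs_magnetization hn (mul_mem_hypercube hσ hτ) hm
    exact sub_pos.1 (pos_of_mul_pos_right (one_pos.trans_le hgap) n.cast_nonneg)
  have hle := measure_mem_and_mem_le_correlationFactor_mul (hasLaw_hamiltonian hσ)
    (hasLaw_hamiltonian hτ) (hasGaussianLaw_hamiltonian_pair (p := p) σ τ)
    (by rw [covariance_hamiltonian, NNReal.coe_inv, NNReal.coe_natCast]) (by simpa using hn)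
    (by rw [abs_pow]; exact pow_lt_one₀ (abs_nonneg _) hm1 hp) hs hs hsb hsb
  have hreal := ENNReal.toReal_mono (by finiteness) hle
  rw [ENNReal.toReal_mul, ENNReal.toReal_mul,
    ENNReal.toReal_ofReal (correlationFactor_nonneg _ _)] at hreal
  refine hreal.trans_eq ?_
  simp only [measureReal_def, NNReal.coe_inv, NNReal.coe_natCast, div_inv_eq_mul]
  ring

lemma sum_measureReal_hamiltonian_mem_and_mem_le (hn : n ≠ 0) (hp : p ≠ 0) (hs : MeasurableSet s)
    (hsb : ∀ x ∈ s, |x| ≤ b) :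
    ∑ σ ∈ hypercube n, ∑ τ ∈ hypercube n,
        (disorder n p).real {J | hamiltonian J σ ∈ s ∧ hamiltonian J τ ∈ s} ≤
      2 ^ n * ((gaussianReal 0 (n : NNReal)⁻¹).real s ^ 2 *
        (∑ m ∈ hypercube n with |magnetization m| ≠ 1,
          correlationFactor (b ^ 2 * n) (magnetization m ^ p)) +
        2 * (gaussianReal 0 (n : NNReal)⁻¹).real s) := by
  set γ := (gaussianReal 0 (n : NNReal)⁻¹).real s
  set F : (Fin n → ℝ) → ℝ := fun m => if |magnetization m| ≠ 1 then
    γ ^ 2 * correlationFactor (b ^ 2 * n) (magnetization m ^ p) else γ with hF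
  have hpair : ∀ σ ∈ hypercube n, ∀ τ ∈ hypercube n,
      (disorder n p).real {J | hamiltonian J σ ∈ s ∧ hamiltonian J τ ∈ s} ≤ F (σ * τ) := by
    intro σ hσ τ hτ
    by_cases hm : |magnetization (σ * τ)| ≠ 1
    · simpa only [hF, if_pos hm] using measureReal_hamiltonian_mem_and_mem_le hn hp hσ hτ hm hs hsb
    · simp only [hF, if_neg hm]
      exact (measureReal_mono fun J hJ => hJ.1).trans_eq (measureReal_hamiltonian_mem hσ hs)
  have hsum : ∑ m ∈ hypercube n, F m ≤ γ ^ 2 * (∑ m ∈ hypercube n with |magnetization m| ≠ 1,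
      correlationFactor (b ^ 2 * n) (magnetization m ^ p)) + 2 * γ := by
    have hcard : (((hypercube n).filter fun m => |magnetization m| = 1).card : ℝ) ≤ 2 := by
      exact_mod_cast card_abs_magnetization_eq_one_le n
    simp only [hF, Finset.sum_ite, ← Finset.mul_sum, Finset.sum_const, nsmul_eq_mul, not_not]
    gcongr
  calc ∑ σ ∈ hypercube n, ∑ τ ∈ hypercube n,
        (disorder n p).real {J | hamiltonian J σ ∈ s ∧ hamiltonian J τ ∈ s}
      ≤ ∑ σ ∈ hypercube n, ∑ τ ∈ hypercube n, F (σ * τ) :=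
        Finset.sum_le_sum fun σ hσ => Finset.sum_le_sum fun τ hτ => hpair σ hσ τ hτ
    _ = 2 ^ n * ∑ m ∈ hypercube n, F m := by
        rw [Finset.sum_congr rfl fun σ hσ => sum_hypercube_mul hσ F, Finset.sum_const,
          card_hypercube, nsmul_eq_mul]
        norm_cast
    _ ≤ _ := by gcongr

end Hamiltonian

section EntropyLowerBound

variable {s : Set ℝ} {b : ℝ}

lemma eventually_exp_neg_mul_le {a ε : ℝ} (ha : 0 < a) (hε : 0 < ε) :
    ∀ᶠ n : ℕ in atTop, Real.exp (-a * n) ≤ ε :=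
  (Real.tendsto_exp_atBot.comp (tendsto_natCast_atTop_atTop.const_mul_atTop_of_neg
    (neg_lt_zero.2 ha))).eventually_le_const hε

lemma two_pow_eq_exp (n : ℕ) : (2 : ℝ) ^ n = Real.exp (Real.log 2 * n) := by
  rw [mul_comm, Real.exp_nat_mul, Real.exp_log two_pos]

lemma le_two_pow_mul_gaussianReal {n : ℕ} (hn : n ≠ 0) (hs : MeasurableSet s)
    (hsb : ∀ x ∈ s, |x| ≤ b) :
    (√(2 * Real.pi))⁻¹ * volume.real s * Real.exp ((Real.log 2 - b ^ 2 / 2) * n) ≤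
      2 ^ n * (gaussianReal 0 (n : NNReal)⁻¹).real s := by
  have hn1 : (1 : ℝ) ≤ n := by exact_mod_cast Nat.one_le_iff_ne_zero.2 hn
  calc (√(2 * Real.pi))⁻¹ * volume.real s * Real.exp ((Real.log 2 - b ^ 2 / 2) * n)
      = 2 ^ n * ((√(2 * Real.pi))⁻¹ * Real.exp (-(b ^ 2 / 2 * n)) * volume.real s) := by
        rw [two_pow_eq_exp, sub_mul, sub_eq_add_neg, Real.exp_add]
        ring
    _ ≤ 2 ^ n * ((√(2 * Real.pi * (n : NNReal)⁻¹))⁻¹ *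
          Real.exp (-b ^ 2 / (2 * (n : NNReal)⁻¹)) * volume.real s) := by
        have hexp : -(b ^ 2 / 2 * n) = -b ^ 2 / (2 * ((n : NNReal)⁻¹ : NNReal)) := by
          rw [NNReal.coe_inv, NNReal.coe_natCast]
          field_simp
        rw [hexp]
        have hvar : 2 * Real.pi * ((n : NNReal)⁻¹ : NNReal) ≤ 2 * Real.pi :=
          mul_le_of_le_one_right (by positivity) (by simpa using inv_le_one_of_one_le₀ hn1)
        have : (0 : ℝ) < ((n : NNReal)⁻¹ : NNReal) := by simpa using Nat.pos_of_ne_zero hn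
        gcongr
    _ ≤ _ := by
        gcongr
        exact mul_volume_le_gaussianReal (by simpa using hn) hs hsb

lemma tendsto_two_pow_mul_gaussianReal (hb : b ^ 2 / 2 < Real.log 2) (hs : MeasurableSet s)
    (hsb : ∀ x ∈ s, |x| ≤ b) (hpos : 0 < volume.real s) :
    Tendsto (fun n : ℕ => 2 ^ n * (gaussianReal 0 (n : NNReal)⁻¹).real s) atTop atTop := by
  have hexp : Tendsto (fun n : ℕ => (√(2 * Real.pi))⁻¹ * volume.real s *
      Real.exp ((Real.log 2 - b ^ 2 / 2) * n)) atTop atTop :=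
    (Real.tendsto_exp_atTop.comp (tendsto_natCast_atTop_atTop.const_mul_atTop
      (by linarith))).const_mul_atTop (by positivity)
  exact tendsto_atTop_mono' _ ((eventually_ne_atTop 0).mono fun n hn =>
    le_two_pow_mul_gaussianReal hn hs hsb) hexp

open Classical in
lemma exists_withHighProbability_half_lt_card (hb : b ^ 2 / 2 < Real.log 2)
    (hs : MeasurableSet s) (hsb : ∀ x ∈ s, |x| ≤ b) (hpos : 0 < volume.real s) :
    ∃ P : ℕ, ∀ p ≥ P, WithHighProbability (fun n => disorder n p) fun n J =>
      2 ^ n * (gaussianReal 0 (n : NNReal)⁻¹).real s / 2 <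
        ((hypercube n).filter fun σ => hamiltonian J σ ∈ s).card := by
  obtain ⟨P, hP⟩ := exists_eventually_sum_correlationFactor_le hb
  refine ⟨P + 1, fun p hp => .of_forall_measureReal_le fun ε hε => ?_⟩
  have hM := tendsto_two_pow_mul_gaussianReal hb hs hsb hpos
  filter_upwards [hP p (by omega) (ε / 8) (by positivity), hM.eventually_ge_atTop (16 / ε),
    eventually_ne_atTop 0] with n hsum hlarge hn
  set γ := (gaussianReal 0 (n : NNReal)⁻¹).real s
  have hMpos : 0 < 2 ^ n * γ := lt_of_lt_of_le (by positivity) hlarge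
  have hdiag : 2 * (2 ^ n * γ) ≤ ε / 8 * (2 ^ n * γ) ^ 2 := by
    rw [div_le_iff₀ hε] at hlarge
    nlinarith
  have hfirst : ∑ σ ∈ hypercube n, (disorder n p).real {J | hamiltonian J σ ∈ s} = 2 ^ n * γ := by
    rw [Finset.sum_congr rfl fun σ hσ => measureReal_hamiltonian_mem hσ hs,
      Finset.sum_const, card_hypercube, nsmul_eq_mul]
    norm_cast
  have hsecond : ∑ σ ∈ hypercube n, ∑ τ ∈ hypercube n, (disorder n p).real
      ({J | hamiltonian J σ ∈ s} ∩ {J | hamiltonian J τ ∈ s}) ≤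
        (1 + ε / 4) * (2 ^ n * γ) ^ 2 :=
    calc _ ≤ 2 ^ n * (γ ^ 2 * _ + 2 * γ) :=
          sum_measureReal_hamiltonian_mem_and_mem_le hn (by omega) hs hsb
      _ ≤ 2 ^ n * (γ ^ 2 * ((1 + ε / 8) * 2 ^ n) + 2 * γ) := by gcongr
      _ ≤ _ := by linarith
  have hcheb := measureReal_card_filter_mem_le_half (hypercube n)
    (S := fun σ => {J : Tensor n p | hamiltonian J σ ∈ s})
    (fun σ _ => measurable_hamiltonian σ hs) hMpos hfirst hsecond
  simpa only [not_lt, Set.mem_ofPred_eq, mul_div_cancel₀ ε (four_ne_zero' ℝ)] using hcheb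

open Classical in
lemma exists_withHighProbability_exp_lt_card (hb : b ^ 2 / 2 < Real.log 2)
    (hs : MeasurableSet s) (hsb : ∀ x ∈ s, |x| ≤ b) (hpos : 0 < volume.real s) {ε : ℝ}
    (hε : 0 < ε) :
    ∃ P : ℕ, ∀ p ≥ P, WithHighProbability (fun n => disorder n p) fun n J =>
      Real.exp ((Real.log 2 - b ^ 2 / 2 - ε) * n) <
        ((hypercube n).filter fun σ => hamiltonian J σ ∈ s).card := by
  obtain ⟨P, hP⟩ := exists_withHighProbability_half_lt_card hb hs hsb hpos
  refine ⟨P, fun p hp => (hP p hp).mono ?_⟩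
  have hK : 0 < (√(2 * Real.pi))⁻¹ * volume.real s := by positivity
  filter_upwards [eventually_exp_neg_mul_le hε (half_pos hK), eventually_ne_atTop 0]
    with n hdecay hn J hJ
  calc Real.exp ((Real.log 2 - b ^ 2 / 2 - ε) * n)
      = Real.exp (-ε * n) * Real.exp ((Real.log 2 - b ^ 2 / 2) * n) := by
        rw [← Real.exp_add]; ring_nf
    _ ≤ (√(2 * Real.pi))⁻¹ * volume.real s / 2 * Real.exp ((Real.log 2 - b ^ 2 / 2) * n) := by
        gcongr
    _ ≤ 2 ^ n * (gaussianReal 0 (n : NNReal)⁻¹).real s / 2 := by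
        linarith [le_two_pow_mul_gaussianReal hn hs hsb]
    _ < _ := hJ

end EntropyLowerBound

section Annealed

variable {n p : ℕ} {σ : Fin n → ℝ}

lemma mgf_hamiltonian (hσ : σ ∈ hypercube n) (t : ℝ) :
    mgf (fun J : Tensor n p => hamiltonian J σ) (disorder n p) (t * n) =
      Real.exp (t ^ 2 / 2 * n) := by
  rw [mgf_gaussianReal (hasLaw_hamiltonian hσ).map_eq, zero_mul, zero_add, NNReal.coe_inv,
    NNReal.coe_natCast]
  rcases eq_or_ne n 0 with rfl | hn
  · simp
  · congr 1
    field_simp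

lemma integrable_exp_mul_hamiltonian (hσ : σ ∈ hypercube n) (t : ℝ) :
    Integrable (fun J : Tensor n p => Real.exp (t * n * hamiltonian J σ)) (disorder n p) := by
  rw [← mgf_pos_iff, mgf_hamiltonian hσ]
  exact Real.exp_pos _

lemma integrable_partition (n p : ℕ) (t : ℝ) :
    Integrable (fun J : Tensor n p => partition t J) (disorder n p) :=
  integrable_finsetSum _ fun _ hσ => integrable_exp_mul_hamiltonian hσ t

lemma integral_partition (n p : ℕ) (t : ℝ) :
    ∫ J : Tensor n p, partition t J ∂disorder n p =
      Real.exp ((Real.log 2 + t ^ 2 / 2) * n) := by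
  simp only [partition]
  rw [integral_finsetSum _ fun σ hσ => integrable_exp_mul_hamiltonian hσ t]
  refine (Finset.sum_congr rfl fun σ hσ => mgf_hamiltonian hσ t).trans ?_
  rw [Finset.sum_const, card_hypercube, nsmul_eq_mul, add_mul, Real.exp_add, ← two_pow_eq_exp]
  norm_cast

lemma partition_pos (t : ℝ) (J : Tensor n p) : 0 < partition t J :=
  Finset.sum_pos (fun _ _ => Real.exp_pos _) (Finset.card_pos.1 (by simp [card_hypercube]))

lemma withHighProbability_partition_lt (p : ℕ) (t : ℝ) {ε : ℝ} (hε : 0 < ε) :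
    WithHighProbability (fun n => disorder n p) fun n J =>
      partition t J < Real.exp ((Real.log 2 + t ^ 2 / 2 + ε) * n) := by
  refine .of_forall_measureReal_le fun η hη => ?_
  filter_upwards [eventually_exp_neg_mul_le hε hη] with n hn
  have hmarkov := mul_meas_ge_le_integral_of_nonneg
    (Eventually.of_forall fun J => (partition_pos t J).le) (integrable_partition n p t)
    (Real.exp ((Real.log 2 + t ^ 2 / 2 + ε) * n))
  have hsplit : Real.exp ((Real.log 2 + t ^ 2 / 2) * n) =
      Real.exp ((Real.log 2 + t ^ 2 / 2 + ε) * n) * Real.exp (-ε * n) := by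
    rw [← Real.exp_add]; ring_nf
  rw [integral_partition, hsplit] at hmarkov
  simp only [not_lt]
  exact (le_of_mul_le_mul_left hmarkov (Real.exp_pos _)).trans hn

end Annealed

section EnergyBand

variable {n p : ℕ} {β d e δ ε : ℝ}

/-- The configurations whose energy is within `d` of the level `e`. -/
def energyBand (J : Tensor n p) (e d : ℝ) : Set (Fin n → ℝ) :=
  {σ | hamiltonian J σ ∈ Set.Icc (e - d) (e + d)}

lemma mem_energyBand_iff {J : Tensor n p} {σ : Fin n → ℝ} :
    σ ∈ energyBand J e d ↔ |hamiltonian J σ - e| ≤ d := by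
  rw [abs_sub_comm]
  exact Set.mem_Icc_iff_abs_le.symm

lemma weight_eq_sum_indicator (β : ℝ) (J : Tensor n p) (A : Set (Fin n → ℝ)) :
    weight β J A =
      ∑ σ ∈ hypercube n, A.indicator (fun σ => Real.exp (β * n * hamiltonian J σ)) σ := by
  classical
  simp only [weight, Finset.sum_filter, Set.indicator_apply]

lemma weight_add_weight_compl (β : ℝ) (J : Tensor n p) (A : Set (Fin n → ℝ)) :
    weight β J A + weight β J Aᶜ = partition β J := by
  simp only [weight_eq_sum_indicator, ← Finset.sum_add_distrib,
    Set.indicator_self_add_compl_apply, partition]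

lemma weight_mono (β : ℝ) (J : Tensor n p) {A B : Set (Fin n → ℝ)} (hAB : A ⊆ B) :
    weight β J A ≤ weight β J B := by
  simp only [weight_eq_sum_indicator]
  exact Finset.sum_le_sum fun σ _ =>
    Set.indicator_le_indicator_of_subset hAB (fun _ => (Real.exp_pos _).le) σ

lemma weight_univ (β : ℝ) (J : Tensor n p) : weight β J Set.univ = partition β J := by
  simp only [weight_eq_sum_indicator, Set.indicator_univ, partition]

open Classical in
lemma card_mul_exp_le_weight {J : Tensor n p} {A : Set (Fin n → ℝ)} {a : ℝ}
    (ha : ∀ σ ∈ A, a ≤ β * hamiltonian J σ) :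
    ((hypercube n).filter fun σ => σ ∈ A).card * Real.exp (a * n) ≤ weight β J A := by
  rw [← nsmul_eq_mul]
  refine Finset.card_nsmul_le_sum _ _ _ fun σ hσ => Real.exp_le_exp.2 ?_
  rw [mul_right_comm]
  exact mul_le_mul_of_nonneg_right (ha σ (Finset.mem_filter.1 hσ).2) n.cast_nonneg

lemma weight_compl_energyBand_le (β : ℝ) (hd : 0 ≤ d) (J : Tensor n p) :
    weight β J (energyBand J β d)ᶜ ≤
      Real.exp (-(d * (β + d)) * n) * partition (β + d) J +
        Real.exp (d * (β - d) * n) * partition (β - d) J := by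
  have hdn : 0 ≤ d * n := by positivity
  rw [weight_eq_sum_indicator, partition, partition, Finset.mul_sum, Finset.mul_sum,
    ← Finset.sum_add_distrib]
  refine Finset.sum_le_sum fun σ _ => Set.indicator_apply_le' (fun hσ => ?_) fun _ => by positivity
  rw [← Real.exp_add, ← Real.exp_add]
  rcases lt_or_ge (hamiltonian J σ) (β - d) with hlow | hlow
  · refine le_add_of_nonneg_of_le (Real.exp_pos _).le (Real.exp_le_exp.2 ?_)
    linarith [mul_le_mul_of_nonneg_left hlow.le hdn]
  · have hhigh : β + d < hamiltonian J σ := lt_of_not_ge fun h => hσ ⟨hlow, h⟩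
    refine le_add_of_le_of_nonneg (Real.exp_le_exp.2 ?_) (Real.exp_pos _).le
    linarith [mul_le_mul_of_nonneg_left hhigh.le hdn]

lemma exists_pos_le_and_mul_abs_le_and_sq_half_lt (β : ℝ) (he : e ^ 2 / 2 < Real.log 2)
    (hδ : 0 < δ) (hε : 0 < ε) :
    ∃ η > 0, η ≤ δ ∧ |β| * η ≤ ε ∧ (|e| + η) ^ 2 / 2 < Real.log 2 ∧
      (|e| + η) ^ 2 / 2 ≤ e ^ 2 / 2 + ε := by
  have hlin : Tendsto (fun η => |β| * η) (𝓝[>] 0) (𝓝 0) := by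
    have : Continuous fun η => |β| * η := by fun_prop
    simpa using this.continuousWithinAt.tendsto (x := 0) (s := Set.Ioi 0)
  have hsq : Tendsto (fun η => (|e| + η) ^ 2 / 2) (𝓝[>] 0) (𝓝 (e ^ 2 / 2)) := by
    have : Continuous fun η => (|e| + η) ^ 2 / 2 := by fun_prop
    simpa using this.continuousWithinAt.tendsto (x := 0) (s := Set.Ioi 0)
  obtain ⟨η, hη, hηδ, hηβ, hη2, hηε⟩ := (eventually_mem_nhdsWithin.and
    (Eventually.and (Ioc_mem_nhdsGT hδ) ((hlin.eventually_le_const hε).and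
      ((hsq.eventually_lt_const he).and
        (hsq.eventually_le_const (lt_add_of_pos_right _ hε)))))).exists
  exact ⟨η, hη, hηδ.2, hηβ, hη2, hηε⟩

lemma exists_withHighProbability_exp_lt_weight_energyBand (β : ℝ) (he : e ^ 2 / 2 < Real.log 2)
    (hδ : 0 < δ) (hε : 0 < ε) :
    ∃ P : ℕ, ∀ p ≥ P, WithHighProbability (fun n => disorder n p) fun n J =>
      Real.exp ((Real.log 2 - e ^ 2 / 2 + β * e - ε) * n) < weight β J (energyBand J e δ) := by
  classical
  obtain ⟨η, hη, hηδ, hηβ, hη2, hηε⟩ :=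
    exists_pos_le_and_mul_abs_le_and_sq_half_lt β he hδ (ε := ε / 3) (by positivity)
  obtain ⟨P, hP⟩ := exists_withHighProbability_exp_lt_card hη2
    (measurableSet_Icc (a := e - η) (b := e + η))
    (fun x hx => by
      have hdist : |e - x| ≤ η := Set.mem_Icc_iff_abs_le.2 hx
      linarith [abs_sub_comm e x, abs_sub_abs_le_abs_sub x e])
    (by rw [Real.volume_real_Icc]; exact lt_max_of_lt_left (by linarith))
    (ε := ε / 3) (by positivity)
  refine ⟨P, fun p hp => (hP p hp).mono (Eventually.of_forall fun n J hJ => ?_)⟩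
  have hmin : ∀ σ ∈ energyBand J e η, β * e - ε / 3 ≤ β * hamiltonian J σ := fun σ hσ => by
    have hdist : |hamiltonian J σ - e| ≤ η := mem_energyBand_iff.1 hσ
    have hprod : |β * (hamiltonian J σ - e)| ≤ ε / 3 := by
      rw [abs_mul]
      exact (mul_le_mul_of_nonneg_left hdist (abs_nonneg β)).trans hηβ
    linarith [neg_abs_le (β * (hamiltonian J σ - e))]
  calc Real.exp ((Real.log 2 - e ^ 2 / 2 + β * e - ε) * n)
      ≤ Real.exp ((Real.log 2 - (|e| + η) ^ 2 / 2 - ε / 3) * n) *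
          Real.exp ((β * e - ε / 3) * n) := by
        rw [← Real.exp_add, ← add_mul]
        gcongr
        linarith
    _ < ((hypercube n).filter fun σ => σ ∈ energyBand J e η).card *
          Real.exp ((β * e - ε / 3) * n) := by
        gcongr
        convert! hJ using 4
    _ ≤ weight β J (energyBand J e η) := card_mul_exp_le_weight hmin
    _ ≤ weight β J (energyBand J e δ) :=
        weight_mono β J fun σ hσ => Set.Icc_subset_Icc (by linarith) (by linarith) hσ

lemma withHighProbability_weight_compl_energyBand_lt (p : ℕ) (β : ℝ) (hd : 0 ≤ d) (hε : 0 < ε) :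
    WithHighProbability (fun n => disorder n p) fun n J =>
      weight β J (energyBand J β d)ᶜ <
        2 * Real.exp ((Real.log 2 + β ^ 2 / 2 - d ^ 2 / 2 + ε) * n) := by
  refine ((withHighProbability_partition_lt p (β + d) hε).and
    (withHighProbability_partition_lt p (β - d) hε)).mono
      (Eventually.of_forall fun n J hJ => ?_)
  calc weight β J (energyBand J β d)ᶜ
      ≤ Real.exp (-(d * (β + d)) * n) * partition (β + d) J +
        Real.exp (d * (β - d) * n) * partition (β - d) J := weight_compl_energyBand_le β hd J
    _ < Real.exp (-(d * (β + d)) * n) *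
          Real.exp ((Real.log 2 + (β + d) ^ 2 / 2 + ε) * n) +
        Real.exp (d * (β - d) * n) * Real.exp ((Real.log 2 + (β - d) ^ 2 / 2 + ε) * n) := by
        gcongr
        exacts [hJ.1, hJ.2]
    _ = _ := by
        rw [← Real.exp_add, ← Real.exp_add, two_mul]
        ring_nf

lemma exists_withHighProbability_two_mul_weight_compl_le (hβ : β ^ 2 / 2 < Real.log 2)
    (hd : 0 < d) :
    ∃ P : ℕ, ∀ p ≥ P, WithHighProbability (fun n => disorder n p) fun n J =>
      2 * weight β J (energyBand J β d)ᶜ ≤ Real.exp (-(d ^ 2 / 8 * n)) * partition β J := by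
  have hd2 : 0 < d ^ 2 / 8 := by positivity
  obtain ⟨P, hP⟩ := exists_withHighProbability_exp_lt_weight_energyBand β hβ hd hd2
  refine ⟨P, fun p hp => ((hP p hp).and
    (withHighProbability_weight_compl_energyBand_lt p β hd.le hd2)).mono ?_⟩
  filter_upwards [eventually_exp_neg_mul_le hd2 (show (0 : ℝ) < 1 / 4 by norm_num)]
    with n hn J ⟨hlower, hupper⟩
  calc 2 * weight β J (energyBand J β d)ᶜ
      ≤ 4 * Real.exp ((Real.log 2 + β ^ 2 / 2 - d ^ 2 / 2 + d ^ 2 / 8) * n) := by linarith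
    _ = 4 * Real.exp (-(d ^ 2 / 8) * n) * Real.exp (-(d ^ 2 / 8 * n)) *
          Real.exp ((Real.log 2 - β ^ 2 / 2 + β * β - d ^ 2 / 8) * n) := by
        rw [mul_assoc, mul_assoc, ← Real.exp_add, ← Real.exp_add]
        ring_nf
    _ ≤ 1 * Real.exp (-(d ^ 2 / 8 * n)) * partition β J := by
        gcongr
        · linarith
        · exact hlower.le.trans ((weight_mono β J (Set.subset_univ _)).trans_eq (weight_univ β J))
    _ = _ := by rw [one_mul]

lemma exists_sq_half_lt_log_two_and_lt_abs_sub (hβ : |β| < √(2 * Real.log 2)) (hd : 0 < d)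
    (hd' : d < √(2 * Real.log 2) + |β|) : ∃ e, e ^ 2 / 2 < Real.log 2 ∧ d < |e - β| := by
  obtain ⟨e, he, hde⟩ : ∃ e, |e| < √(2 * Real.log 2) ∧ d < |e - β| := by
    have hβ' := abs_lt.1 hβ
    rcases le_total 0 β with h | h
    · rw [abs_of_nonneg h] at hd'
      obtain ⟨e, he, he'⟩ := exists_between (show -√(2 * Real.log 2) < β - d by linarith)
      exact ⟨e, abs_lt.2 ⟨he, by linarith⟩, lt_abs.2 (Or.inr (by linarith))⟩
    · rw [abs_of_nonpos h] at hd'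
      obtain ⟨e, he, he'⟩ := exists_between (show β + d < √(2 * Real.log 2) by linarith)
      exact ⟨e, abs_lt.2 ⟨by linarith, he'⟩, lt_abs.2 (Or.inl (by linarith))⟩
  rw [Real.lt_sqrt (abs_nonneg e), sq_abs] at he
  exact ⟨e, by linarith, hde⟩

lemma exists_withHighProbability_exp_mul_partition_le_weight_compl
    (hβ : |β| < √(2 * Real.log 2)) (hd : 0 < d) (hd' : d < √(2 * Real.log 2) + |β|) :
    ∃ C : ℝ, ∃ P : ℕ, ∀ p ≥ P, WithHighProbability (fun n => disorder n p) fun n J =>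
      Real.exp (-(C * n)) * partition β J ≤ weight β J (energyBand J β d)ᶜ := by
  obtain ⟨e, he, hde⟩ := exists_sq_half_lt_log_two_and_lt_abs_sub hβ hd hd'
  obtain ⟨P, hP⟩ := exists_withHighProbability_exp_lt_weight_energyBand β he
    (δ := (|e - β| - d) / 2) (by linarith) one_pos
  refine ⟨(β - e) ^ 2 / 2 + 2, P, fun p hp => ((hP p hp).and
    (withHighProbability_partition_lt p β one_pos)).mono
      (Eventually.of_forall fun n J ⟨hlower, hupper⟩ => ?_)⟩
  have hsub : energyBand J e ((|e - β| - d) / 2) ⊆ (energyBand J β d)ᶜ := fun σ hσ hσβ => by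
    have hσe : |hamiltonian J σ - e| ≤ (|e - β| - d) / 2 := mem_energyBand_iff.1 hσ
    have hσβ' : |hamiltonian J σ - β| ≤ d := mem_energyBand_iff.1 hσβ
    rw [abs_sub_comm] at hσe
    linarith [abs_sub_le e (hamiltonian J σ) β]
  calc Real.exp (-(((β - e) ^ 2 / 2 + 2) * n)) * partition β J
      ≤ Real.exp (-(((β - e) ^ 2 / 2 + 2) * n)) *
          Real.exp ((Real.log 2 + β ^ 2 / 2 + 1) * n) := by gcongr
    _ = Real.exp ((Real.log 2 - e ^ 2 / 2 + β * e - 1) * n) := by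
        rw [← Real.exp_add]
        ring_nf
    _ ≤ weight β J (energyBand J e ((|e - β| - d) / 2)) := hlower.le
    _ ≤ weight β J (energyBand J β d)ᶜ := weight_mono β J hsub

end EnergyBand

section Exponents

variable {a b q A R Z : ℝ}

lemma exists_mem_Icc_exp_neg_eq (hlow : Real.exp (-b) ≤ q) (hupp : q ≤ Real.exp (-a)) :
    ∃ x ∈ Set.Icc a b, Real.exp (-x) = q := by
  have hq : 0 < q := (Real.exp_pos _).trans_le hlow
  refine ⟨-Real.log q, ⟨?_, ?_⟩, by rw [neg_neg, Real.exp_log hq]⟩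
  · exact le_neg_of_le_neg ((Real.log_le_iff_le_exp hq).2 hupp)
  · exact neg_le_of_neg_le ((Real.le_log_iff_exp_le hq).2 hlow)

lemma exists_exponents_of_add_eq (hZ : 0 < Z) (hAR : A + R = Z) (ha : 0 ≤ a)
    (hlow : Real.exp (-b) * Z ≤ R) (hupp : 2 * R ≤ Real.exp (-a) * Z) :
    (∃ x ∈ Set.Icc a b, Z = A * (1 + Real.exp (-x))) ∧
      ∃ y ∈ Set.Icc a b, A / Z = 1 - Real.exp (-y) := by
  have hR : 0 < R := lt_of_lt_of_le (by positivity) hlow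
  have hZA : Z ≤ 2 * A := by
    have : Real.exp (-a) * Z ≤ 1 * Z := by gcongr; exact Real.exp_le_one_iff.2 (by linarith)
    linarith
  have hA : 0 < A := by linarith
  obtain ⟨x, hx, hxR⟩ := exists_mem_Icc_exp_neg_eq (q := R / A) (a := a) (b := b)
    ((le_div_iff₀ hA).2 (le_trans (by gcongr; linarith) hlow))
    ((div_le_iff₀ hA).2 (by nlinarith [Real.exp_pos (-a)]))
  obtain ⟨y, hy, hyR⟩ := exists_mem_Icc_exp_neg_eq (q := R / Z) (a := a) (b := b)
    ((le_div_iff₀ hZ).2 hlow) ((div_le_iff₀ hZ).2 (by linarith))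
  refine ⟨⟨x, hx, ?_⟩, y, hy, ?_⟩
  · rw [hxR, mul_one_add, mul_div_cancel₀ R hA.ne', hAR]
  · rw [hyR, one_sub_div hZ.ne', ← hAR, add_sub_cancel_right]

end Exponents

section NormalizedBand

variable {n p : ℕ}

lemma sqrt_two_mul_log_two_pos : 0 < √(2 * Real.log 2) :=
  Real.sqrt_pos.2 (mul_pos two_pos (Real.log_pos one_lt_two))

lemma restrictedPartition_eq_weight_energyBand (β κ e : ℝ) (J : Tensor n p) :
    restrictedPartition β J (e / √(2 * Real.log 2) - κ) (e / √(2 * Real.log 2) + κ) =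
      weight β J (energyBand J e (κ * √(2 * Real.log 2))) := by
  have hw := sqrt_two_mul_log_two_pos.ne'
  simp only [restrictedPartition, energyBand, Set.mem_Icc, sub_mul, add_mul, div_mul_cancel₀ e hw]

lemma setOf_hamiltonian_div_mem_Icc (κ e : ℝ) (J : Tensor n p) :
    {σ | hamiltonian J σ / √(2 * Real.log 2) ∈
        Set.Icc (e / √(2 * Real.log 2) - κ) (e / √(2 * Real.log 2) + κ)} =
      energyBand J e (κ * √(2 * Real.log 2)) := by
  have hw := sqrt_two_mul_log_two_pos
  ext σ
  simp only [energyBand, Set.mem_ofPred_eq, Set.mem_Icc, le_div_iff₀ hw, div_le_iff₀ hw, sub_mul,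
    add_mul, div_mul_cancel₀ e hw.ne']

end NormalizedBand

end PSpin

theorem mainTheorem6_general (β κ : ℝ) (hβ : |β| < √(2 * Real.log 2)) (hκ : 0 < κ)
    (hκ' : κ < 1 + |β| / √(2 * Real.log 2)) :
    ∃ c C : ℝ, 0 < c ∧ c ≤ C ∧ ∃ P : ℕ, ∀ p : ℕ, P ≤ p →
      Tendsto (fun n : ℕ => PSpin.disorder n p {J : PSpin.Tensor n p |
          (∃ x ∈ Set.Icc (c * n) (C * n),
            PSpin.partition β J =
              PSpin.restrictedPartition β J (β / √(2 * Real.log 2) - κ)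
                (β / √(2 * Real.log 2) + κ) * (1 + Real.exp (-x))) ∧
          (∃ y ∈ Set.Icc (c * n) (C * n),
            PSpin.gibbs β J {σ | PSpin.hamiltonian J σ / √(2 * Real.log 2) ∈
                Set.Icc (β / √(2 * Real.log 2) - κ) (β / √(2 * Real.log 2) + κ)} =
              1 - Real.exp (-y))})
        atTop (𝓝 1) := by
  have hw := PSpin.sqrt_two_mul_log_two_pos
  have hd : 0 < κ * √(2 * Real.log 2) := mul_pos hκ hw
  have hd' : κ * √(2 * Real.log 2) < √(2 * Real.log 2) + |β| := by
    simpa only [add_mul, one_mul, div_mul_cancel₀ _ hw.ne'] using mul_lt_mul_of_pos_right hκ' hw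
  have hβ2 : β ^ 2 / 2 < Real.log 2 := by
    rw [Real.lt_sqrt (abs_nonneg β), sq_abs] at hβ
    linarith
  obtain ⟨P₁, hupper⟩ := PSpin.exists_withHighProbability_two_mul_weight_compl_le hβ2 hd
  obtain ⟨C, P₂, hlower⟩ :=
    PSpin.exists_withHighProbability_exp_mul_partition_le_weight_compl hβ hd hd'
  refine ⟨(κ * √(2 * Real.log 2)) ^ 2 / 8, max ((κ * √(2 * Real.log 2)) ^ 2 / 8) C,
    by positivity, le_max_left _ _, max P₁ P₂, fun p hp => ?_⟩
  refine (((hupper p ((le_max_left _ _).trans hp)).and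
    (hlower p ((le_max_right _ _).trans hp))).mono
      (Eventually.of_forall fun n J ⟨hJ, hJ'⟩ => ?_)).tendsto_measure
  rw [PSpin.restrictedPartition_eq_weight_energyBand, PSpin.setOf_hamiltonian_div_mem_Icc]
  have hZ := PSpin.partition_pos β J
  refine PSpin.exists_exponents_of_add_eq hZ (PSpin.weight_add_weight_compl β J _)
    (by positivity) (le_trans ?_ hJ') hJ
  gcongr
  exact le_max_right _ _

theorem mainTheorem6 (β κ : ℝ) (hβ : 0 < β) (hβ' : β < √(2 * Real.log 2))
    (hκ : 0 < κ) (hκ' : κ < 1 / √2) :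
    ∃ P : ℕ, ∀ p : ℕ, P ≤ p → ∃ c C : ℝ, 0 < c ∧ c ≤ C ∧
      Tendsto (fun n : ℕ => PSpin.disorder n p {J : PSpin.Tensor n p |
          (∃ x ∈ Set.Icc (c * n) (C * n),
            PSpin.partition β J =
              PSpin.restrictedPartition β J (β / √(2 * Real.log 2) - κ)
                (β / √(2 * Real.log 2) + κ) * (1 + Real.exp (-x))) ∧
          (∃ y ∈ Set.Icc (c * n) (C * n),
            PSpin.gibbs β J {σ | PSpin.hamiltonian J σ / √(2 * Real.log 2) ∈
                Set.Icc (β / √(2 * Real.log 2) - κ) (β / √(2 * Real.log 2) + κ)} =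
              1 - Real.exp (-y))})
        atTop (𝓝 1) := by
  have hκ_lt_one : κ < 1 := hκ'.trans (by
    rw [one_div]; exact inv_lt_one_of_one_lt₀ Real.one_lt_sqrt_two)
  obtain ⟨c, C, hc, hcC, P, hP⟩ := mainTheorem6_general β κ (by rwa [abs_of_pos hβ]) hκ
    (hκ_lt_one.trans_le (le_add_of_nonneg_right (by positivity)))
  exact ⟨P, fun p hp => ⟨c, C, hc, hcC, hP p hp⟩⟩
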